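/- Let $L\ge 1$ be an integer (the number of antennas per node), $\alpha>2$, $\theta>0$, $d>0$, $\beta\ge 0$, $\lambda>0$, and put $\delta=2/\alpha$. Let $\{T_n\}$ be the points of a homogeneous Poisson point process of density $\lambda$ in the plane (the interferers of a typical receiver at the origin), let $\rho_n$ be i.i.d. exponential random variables of mean $1$ that are independent of the positions, and let $I_n=|T_n|^{-\alpha}\rho_n$ be the interference power from $T_n$. Let $W$ be independent of $(T_n,\rho_n)_n$ with probability density $e^{-w}/P_t$ on $w\ge \beta d^\alpha$, where $P_t=e^{-\beta d^\alpha}$; the power of the data link is $d^{-\alpha}W$. The $L-1$ interferers with the largest powers $I_n$ are perfectly canceled. Let $G$ be the power of the strongest remaining (primary) interferer, i.e. the $L$-th largest of the $I_n$, and let $I_\Pi$ be the sum of the powers of all weaker (secondary) interferers. The outage probability is $$P_{\rm out}(\lambda)=\Pr\Big(\frac{d^{-\alpha}W}{G+I_\Pi}\le\theta\Big).$$ Then the following bounds hold. 1. $P_{\rm out}(\lambda)\ge P^L_{\rm out}(\lambda):=\frac{1}{\Gamma(L)}\,\mathbf E\big[\gamma\big(L,\,c_2\lambda W^{-\delta}\big)\big]$,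 where $c_2=\pi\Gamma(1+\delta)\theta^\delta d^2$ and $\gamma(s,x)=\int_0^x t^{s-1}e^{-t}\,dt$. 2. $P_{\rm out}(\lambda)\le P^L_{\rm out}(\lambda)+\big[1-P^L_{\rm out}(\lambda)\big]P_\alpha(\lambda)$, where $$P_\alpha(\lambda)=\mathbf E\Big[\Lambda\ \Big|\ \frac WG>d^\alpha\theta\Big],\qquad M=d^{-\alpha}\theta^{-1}W-G-c_4\lambda G^{1-\delta},$$ $$\Lambda=\min\Big\{\frac{c_3\lambda G^{2-\delta}}{M^2},\,1\Big\}\ \text{ if } M>0,\qquad \Lambda=1\ \text{ if } M\le 0,$$ $c_3=\dfrac{\pi\Gamma(1+\delta)}{\alpha-1}$ and $c_4=\dfrac{2\pi\Gamma(1+\delta)}{\alpha-2}$. ($\Lambda$ is the bound that Chebyshev's inequality gives for $\Pr(I_\Pi\ge d^{-\alpha}\theta^{-1}W-G\mid G,W)$ from the conditional mean $c_4\lambda G^{1-\delta}$ and variance $c_3\lambda G^{2-\delta}$ of $I_\Pi$ given $G$.) If the network is sparse in the sense that $c_4^2\lambda\le c_3\,(\beta/(2\theta))^\delta$, the same upper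 bound holds with $$P_\alpha(\lambda)=\mathbf E\Big[\min\Big\{\frac{c_3\lambda G^{2-\delta}}{M^2},\,1\Big\}\ \Big|\ \frac WG>d^\alpha\theta\Big].$$ -/

import Mathlib

open MeasureTheory ProbabilityTheory
open scoped ENNReal NNReal

noncomputable section

namespace MANET

/-! ### Poisson point processes -/

/-- The number of indices `n` such that the point `T n ω` lies in `A`. -/
def pointCount {Ω E : Type*} (T : ℕ → Ω → E) (A : Set E) (ω : Ω) : ℕ∞ :=
  {n | T n ω ∈ A}.encard

/-- The points `T 0, T 1, …` enumerate (in an arbitrary order) a Poisson point process with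
intensity measure `ν`: the number of points in a measurable set of finite intensity is Poisson
distributed, and the numbers of points in disjoint measurable sets are independent. -/
structure IsPoissonProcess {Ω E : Type*} [MeasurableSpace Ω] [MeasurableSpace E]
    (T : ℕ → Ω → E) (ν : Measure E) (P : Measure Ω) : Prop where
  measurable : ∀ n, Measurable (T n)
  law_count : ∀ A : Set E, MeasurableSet A → ν A ≠ ∞ → ∀ k : ℕ,
    P {ω | pointCount T A ω = k} = poissonMeasure (ν A).toNNReal {k}
  indep_count : ∀ (k : ℕ) (A : Fin k → Set E), (∀ i, MeasurableSet (A i)) →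
    Pairwise (fun i j => Disjoint (A i) (A j)) → iIndepFun (fun i => pointCount T (A i)) P

/-! ### Interference powers and cancelation -/

/-- The interference power `r ^ (-α) * ρ` received at the origin from an interferer at `x`, where
`r = ‖x‖` is its distance and `ρ` is its fading power. -/
def interfPower (α : ℝ) (x : EuclideanSpace ℝ (Fin 2)) (ρ : ℝ) : ℝ≥0∞ :=
  ENNReal.ofReal (‖x‖ ^ (-α) * ρ)

/-- The interferers that are stronger than the interferer `n` (ties are broken by the index), when
the interferer `m` has power `I m`. -/
def stronger (I : ℕ → ℝ≥0∞) (n : ℕ) : Set ℕ :=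
  {m | I n < I m ∨ (I m = I n ∧ m < n)}

/-- The interferers left after the `L - 1` strongest ones have been canceled: those for which at
least `L - 1` other interferers are stronger. -/
def residual (L : ℕ) (I : ℕ → ℝ≥0∞) : Set ℕ :=
  {n | (L : ℕ∞) ≤ (stronger I n).encard + 1}

/-- The total interference power that remains after cancelation. -/
def residualPower (L : ℕ) (I : ℕ → ℝ≥0∞) : ℝ≥0∞ :=
  ∑' n, (residual L I).indicator I n

/-- The power of the primary interferer, i.e. of the strongest interferer that is not canceled. -/
def primaryPower (L : ℕ) (I : ℕ → ℝ≥0∞) : ℝ :=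
  (⨆ n ∈ residual L I, I n).toReal

/-- The power `d ^ (-α) * W` of the data link divided by the residual interference power; it is
`∞` if a positive power meets no interference. -/
def sir (L : ℕ) (α d W : ℝ) (I : ℕ → ℝ≥0∞) : ℝ≥0∞ :=
  ENNReal.ofReal (d ^ (-α) * W) / residualPower L I

/-- The law with density `exp (-w) / Pt` on `w ≥ β * d ^ α`, where `Pt = exp (-(β * d ^ α))`. -/
def dataGainLaw (α d β : ℝ) : Measure ℝ :=
  volume.withDensity fun w =>
    if β * d ^ α ≤ w then ENNReal.ofReal (Real.exp (-w) / Real.exp (-(β * d ^ α))) else 0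

/-! ### The quantities in the bounds -/

/-- The lower incomplete gamma function `γ(s, x)`. -/
def lowerGamma (s x : ℝ) : ℝ := ∫ t in (0 : ℝ)..x, t ^ (s - 1) * Real.exp (-t)

/-- `δ = 2 / α` -/
def delta (α : ℝ) : ℝ := 2 / α

def c₂ (α θ d : ℝ) : ℝ := Real.pi * Real.Gamma (1 + delta α) * θ ^ delta α * d ^ 2

def c₃ (α : ℝ) : ℝ := Real.pi * Real.Gamma (1 + delta α) / (α - 1)

def c₄ (α : ℝ) : ℝ := 2 * Real.pi * Real.Gamma (1 + delta α) / (α - 2)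

/-- `E[γ(L, c₂ λ W ^ (-δ))] / Γ(L)` -/
def outageLower {Ω : Type*} [MeasurableSpace Ω] (P : Measure Ω) (L : ℕ) (α θ d lam : ℝ)
    (W : Ω → ℝ) : ℝ :=
  1 / Real.Gamma L * ∫ ω, lowerGamma L (c₂ α θ d * lam * W ω ^ (-delta α)) ∂P

/-- By how much the secondary interference needed for an outage, `d ^ (-α) * θ⁻¹ * w - g`,
exceeds the conditional mean `c₄ λ g ^ (1 - δ)` of the secondary interference. -/
def margin (α θ d lam w g : ℝ) : ℝ :=
  d ^ (-α) * θ⁻¹ * w - g - c₄ α * lam * g ^ (1 - delta α)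

/-- The Chebyshev ratio: the conditional variance `c₃ λ g ^ (2 - δ)` of the secondary interference
over the squared margin. -/
def chebRatio (α θ d lam w g : ℝ) : ℝ :=
  c₃ α * lam * g ^ (2 - delta α) / margin α θ d lam w g ^ 2

/-- The bound on the conditional outage probability that Chebyshev's inequality gives: it says
something only if the margin is positive, and is the trivial bound `1` otherwise. -/
def chebBound (α θ d lam w g : ℝ) : ℝ :=
  if 0 < margin α θ d lam w g then min (chebRatio α θ d lam w g) 1 else 1

/-- `P_α(λ)`: the mean of the Chebyshev bound given the event `W / G > d ^ α * θ`. -/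
def Pα {Ω : Type*} [MeasurableSpace Ω] (P : Measure Ω) (α θ d lam : ℝ) (W G : Ω → ℝ) : ℝ :=
  ∫ ω, chebBound α θ d lam (W ω) (G ω) ∂(P[|{ω | d ^ α * θ < W ω / G ω}])

/-- The variant of `P_α(λ)` in which the Chebyshev ratio is used whatever the sign of the margin. -/
def Pα' {Ω : Type*} [MeasurableSpace Ω] (P : Measure Ω) (α θ d lam : ℝ) (W G : Ω → ℝ) : ℝ :=
  ∫ ω, min (chebRatio α θ d lam (W ω) (G ω)) 1 ∂(P[|{ω | d ^ α * θ < W ω / G ω}])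

end MANET

end

namespace MANET

open Filter Topology

/-! ### The function `x ↦ exp (-x)` on `[0, ∞]` -/

/-! Put `C = λ π Γ(1 + δ)`. By the marking and mapping theorems the interference powers form a
Poisson process on `[0, ∞]` whose intensity has tail `C * y ^ (-δ)` (`hasPowerTail_powerIntensity`).
From here on the plane plays no role. The marking theorem (`HasPoissonCounts.prodMk`) is obtained
from Laplace functionals: they determine the joint moments of `exp (-N i)` for the counts `N i` of
disjoint sets, and a measure on a cube is determined by its moments.

The primary power `G` exceeds `y` exactly when at least `L` powers do, almost surely. Hence `G ≤ y`
has the probability that a Poisson variable of mean `C * y ^ (-δ)` is below `L`, which is one minus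
a normalized incomplete gamma function. An outage means that the residual power reaches the level `t
= d ^ (-α) * θ⁻¹ * W`. If `G > t`, there is an outage; averaging over `W` gives the lower bound
(`HasPoissonCounts.measure_primarySup_le_level`).

For the upper bound it remains to control an outage with `G ≤ t`. Given `G = g`, the secondary
powers are a Poisson process below `g`, whose sum has mean `C * δ / (1 - δ) * g ^ (1 - δ)` and
variance `C * δ / (2 - δ) * g ^ (2 - δ)`, so Chebyshev's inequality applies. Conditioning on the
null event `G = g` is replaced by a grid. If `G` lies in a bin `(x, x']` that holds at most one
power, the residual power is at most `x'` plus the sum of the powers up to `x`. The event itself is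
expressed by counts above `x`, hence is independent of that sum (`HasPoissonCounts.measure_bin_le`).
Two powers in one bin have probability at most the squared intensity of the bin; over the grid these
errors add up to a multiple of the mesh and vanish in the limit. Then the lower end of the grid
tends to `0`, and independence lets `W` be inserted for the fixed level
(`HasPoissonCounts.measure_secondary_le`).

In a sparse network a negative margin forces the Chebyshev ratio to be at least `1`
(`chebBound_le_of_sparse`), so the case distinction can be dropped; a zero margin has probability
`0`. Of the law of `W` only two facts enter: `W ≥ β * d ^ α` almost surely, and there are no atoms.
-/

/-- `exp (-x)` for `x ∈ [0, ∞]` -/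
noncomputable def negExp (x : ℝ≥0∞) : ℝ≥0∞ := (EReal.exp (x : EReal))⁻¹

lemma negExp_zero : negExp 0 = 1 := by simp [negExp]

lemma negExp_top : negExp ∞ = 0 := by simp [negExp]

lemma negExp_ofReal {a : ℝ} (ha : 0 ≤ a) :
    negExp (ENNReal.ofReal a) = ENNReal.ofReal (Real.exp (-a)) := by
  rw [negExp, EReal.coe_ennreal_ofReal, max_eq_left ha, EReal.exp_coe,
    ← ENNReal.ofReal_inv_of_pos (Real.exp_pos _), Real.exp_neg]

lemma negExp_add (x y : ℝ≥0∞) : negExp (x + y) = negExp x * negExp y := by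
  have h (z : ℝ≥0∞) : EReal.exp (z : EReal) ≠ 0 := by simp
  rw [negExp, EReal.coe_ennreal_add, EReal.exp_add, ENNReal.mul_inv (Or.inl (h x)) (Or.inr (h y))]
  rfl

lemma negExp_le_one (x : ℝ≥0∞) : negExp x ≤ 1 := by
  rw [negExp, ENNReal.inv_le_one, EReal.one_le_exp_iff]
  exact EReal.coe_ennreal_nonneg x

lemma negExp_ne_top (x : ℝ≥0∞) : negExp x ≠ ∞ :=
  ne_top_of_le_ne_top ENNReal.one_ne_top (negExp_le_one x)

lemma continuous_negExp : Continuous negExp :=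
  continuous_inv.comp (ENNReal.continuous_exp.comp continuous_coe_ennreal_ereal)

lemma measurable_negExp : Measurable negExp := continuous_negExp.measurable

lemma antitone_negExp : Antitone negExp := fun x y h => by
  rw [negExp, negExp, ENNReal.inv_le_inv, EReal.exp_le_exp_iff]
  exact_mod_cast h

lemma injective_negExp : Function.Injective negExp := fun x y h => by
  rw [negExp, negExp, inv_inj] at h
  exact_mod_cast EReal.exp_strictMono.injective h

lemma negExp_sum {ι : Type*} (s : Finset ι) (f : ι → ℝ≥0∞) :
    negExp (∑ i ∈ s, f i) = ∏ i ∈ s, negExp (f i) := by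
  classical
  induction s using Finset.induction_on with
  | empty => simp [negExp_zero]
  | insert a s ha ih => rw [Finset.sum_insert ha, Finset.prod_insert ha, negExp_add, ih]

lemma negExp_natCast_mul (n : ℕ) (x : ℝ≥0∞) : negExp (n * x) = negExp x ^ n := by
  simpa using negExp_sum (Finset.range n) fun _ => x

lemma one_sub_negExp_toReal (x : ℝ≥0∞) :
    ENNReal.ofReal (1 - (negExp x).toReal) = 1 - negExp x := by
  rw [ENNReal.ofReal_sub _ ENNReal.toReal_nonneg, ENNReal.ofReal_one,
    ENNReal.ofReal_toReal (negExp_ne_top x)]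

/-- With `q = exp (-c)` the series is `exp (-r) * ∑ (r * q) ^ n / n!`, which is `exp (-(1 - q) *
r)`. The value `c = ∞` is covered by `q = 0`. -/
lemma lintegral_negExp_poissonMeasure (r : ℝ≥0) (c : ℝ≥0∞) :
    ∫⁻ n, negExp (c * (n : ℝ≥0∞)) ∂(poissonMeasure r) = negExp ((1 - negExp c) * r) := by
  rw [lintegral_countable']
  set q := (negExp c).toReal
  have hq0 : 0 ≤ q := ENNReal.toReal_nonneg
  have hq1 : q ≤ 1 := ENNReal.toReal_le_of_le_ofReal one_pos.le (by simpa using negExp_le_one c)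
  have hq : negExp c = ENNReal.ofReal q := (ENNReal.ofReal_toReal (negExp_ne_top c)).symm
  have hr : (r : ℝ≥0∞) = ENNReal.ofReal r := by simp
  have h1 : ∀ n : ℕ, negExp (c * (n : ℝ≥0∞)) * poissonMeasure r {n} =
      ENNReal.ofReal (Real.exp (-r) * ((r * q) ^ n / n.factorial)) := by
    intro n
    rw [mul_comm c, negExp_natCast_mul, poissonMeasure_singleton, hq,
      ← ENNReal.ofReal_pow hq0, ← ENNReal.ofReal_mul (pow_nonneg hq0 n), mul_pow]
    congr 1
    ring
  have hs : HasSum (fun n : ℕ => Real.exp (-r) * ((r * q) ^ n / n.factorial))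
      (Real.exp (-r) * Real.exp (r * q)) := by
    have := NormedSpace.expSeries_div_hasSum_exp (𝔸 := ℝ) (r * q)
    rw [← Real.exp_eq_exp_ℝ] at this
    exact this.mul_left _
  simp_rw [h1]
  rw [← ENNReal.ofReal_tsum_of_nonneg (fun n => by positivity) hs.summable, hs.tsum_eq,
    ← Real.exp_add, hr, ← one_sub_negExp_toReal, ← ENNReal.ofReal_mul (sub_nonneg.2 hq1),
    negExp_ofReal (mul_nonneg (sub_nonneg.2 hq1) r.coe_nonneg)]
  congr 2
  ring

/-! ### Counts of points -/

lemma tsum_indicator_eq_pointCount {Ω E : Type*} (T : ℕ → Ω → E) (A : Set E) (c : ℝ≥0∞) (ω : Ω) :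
    ∑' n, A.indicator (fun _ => c) (T n ω) = c * (pointCount T A ω : ℝ≥0∞) := by
  have h := ENNReal.tsum_set_const {n | T n ω ∈ A} c
  rw [tsum_subtype {n | T n ω ∈ A} fun _ => c] at h
  rw [pointCount, mul_comm, ← h]
  rfl

section Counts

variable {Ω E : Type*} [MeasurableSpace Ω] [MeasurableSpace E] {T : ℕ → Ω → E} {P : Measure Ω}
  {ν : Measure E}

lemma measurable_encard_setOf {p : ℕ → Ω → Prop} (hp : ∀ n, MeasurableSet {ω | p n ω}) :
    Measurable fun ω => {n | p n ω}.encard :=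
  measurable_encard.comp (measurable_set_iff.2 fun n => measurable_to_prop (by simpa [Set.preimage] using hp n))

lemma measurable_pointCount (hT : ∀ n, Measurable (T n)) {A : Set E} (hA : MeasurableSet A) :
    Measurable (pointCount T A) :=
  measurable_encard_setOf fun n => hT n hA

/-- The points `T 0, T 1, …` have the counts of a Poisson process of intensity `ν`, as far as
sets of finite intensity are concerned. -/
structure HasPoissonCounts (T : ℕ → Ω → E) (ν : Measure E) (P : Measure Ω) : Prop where
  measurable : ∀ n, Measurable (T n)
  map_pointCount : ∀ A : Set E, MeasurableSet A → ν A ≠ ∞ →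
    P.map (pointCount T A) = (poissonMeasure (ν A).toNNReal).map (fun n : ℕ => (n : ℕ∞))
  indep_fin : ∀ (k : ℕ) (A : Fin k → Set E), (∀ i, MeasurableSet (A i)) → (∀ i, ν (A i) ≠ ∞) →
    Pairwise (fun i j => Disjoint (A i) (A j)) → iIndepFun (fun i => pointCount T (A i)) P

/-- The finite values already carry total mass `1` under the Poisson law, so nothing is left for
`⊤`. -/
lemma map_eq_map_poissonMeasure [IsProbabilityMeasure P] {N : Ω → ℕ∞} (hN : Measurable N) {r : ℝ≥0}
    (h : ∀ k : ℕ, P {ω | N ω = k} = poissonMeasure r {k}) :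
    P.map N = (poissonMeasure r).map (fun n : ℕ => (n : ℕ∞)) := by
  have hfin : ∀ k : ℕ, P.map N {(k : ℕ∞)} = (poissonMeasure r).map (fun n : ℕ => (n : ℕ∞)) {↑k} := by
    intro k
    rw [Measure.map_apply hN .of_discrete, Measure.map_apply .of_discrete .of_discrete]
    have : (fun n : ℕ => (n : ℕ∞)) ⁻¹' {(k : ℕ∞)} = {k} := by ext; simp
    rw [this, ← h k]
    rfl
  have : IsProbabilityMeasure (P.map N) := Measure.isProbabilityMeasure_map hN.aemeasurable
  have : IsProbabilityMeasure ((poissonMeasure r).map (fun n : ℕ => (n : ℕ∞))) :=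
    Measure.isProbabilityMeasure_map Measurable.of_discrete.aemeasurable
  have hne : P.map N {⊤}ᶜ = (poissonMeasure r).map (fun n : ℕ => (n : ℕ∞)) {⊤}ᶜ := by
    have : ({⊤}ᶜ : Set ℕ∞) = ⋃ k : ℕ, {(k : ℕ∞)} := by
      ext x
      simp only [Set.mem_compl_iff, Set.mem_singleton_iff, Set.mem_iUnion]
      exact ⟨fun hx => ⟨x.toNat, (ENat.natCast_toNat hx).symm⟩, by rintro ⟨k, rfl⟩; simp⟩
    have hd : Pairwise (Function.onFun Disjoint fun k : ℕ => ({(k : ℕ∞)} : Set ℕ∞)) := by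
      intro i j hij
      simpa using hij
    rw [this, measure_iUnion hd fun _ => .of_discrete, measure_iUnion hd fun _ => .of_discrete]
    exact tsum_congr hfin
  refine Measure.ext_of_singleton fun x => ?_
  induction x using ENat.recTopCoe with
  | coe k => exact hfin k
  | top =>
    rw [prob_compl_eq_one_sub .of_discrete, prob_compl_eq_one_sub .of_discrete] at hne
    exact (ENNReal.sub_right_inj ENNReal.one_ne_top prob_le_one prob_le_one).1 hne

lemma IsPoissonProcess.hasPoissonCounts [IsProbabilityMeasure P] (h : IsPoissonProcess T ν P) :
    HasPoissonCounts T ν P where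
  measurable := h.measurable
  map_pointCount A hA hν :=
    map_eq_map_poissonMeasure (measurable_pointCount h.measurable hA) (h.law_count A hA hν)
  indep_fin k A hA _ hd := h.indep_count k A hA hd

namespace HasPoissonCounts

lemma map {F : Type*} [MeasurableSpace F] (h : HasPoissonCounts T ν P) {g : E → F}
    (hg : Measurable g) : HasPoissonCounts (fun n ω => g (T n ω)) (ν.map g) P where
  measurable n := hg.comp (h.measurable n)
  map_pointCount A hA hν := by
    rw [Measure.map_apply hg hA] at hν ⊢
    exact h.map_pointCount _ (hg hA) hν
  indep_fin k A hA hν hd := by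
    refine h.indep_fin k (fun i => g ⁻¹' A i) (fun i => hg (hA i)) (fun i => ?_) fun i j hij =>
      (hd hij).preimage g
    rw [← Measure.map_apply hg (hA i)]
    exact hν i

lemma indep (h : HasPoissonCounts T ν P) {ι : Type*} [Fintype ι] {A : ι → Set E}
    (hA : ∀ i, MeasurableSet (A i)) (hν : ∀ i, ν (A i) ≠ ∞)
    (hd : Pairwise (fun i j => Disjoint (A i) (A j))) :
    iIndepFun (fun i => pointCount T (A i)) P := by
  have e := Fintype.equivFin ι
  rw [← iIndepFun_precomp_of_bijective e.symm.bijective]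
  exact h.indep_fin _ (fun i => A (e.symm i)) (fun i => hA _) (fun i => hν _)
    fun i j hij => hd (e.symm.injective.ne hij)

lemma ae_pointCount_ne_top (h : HasPoissonCounts T ν P) {A : Set E} (hA : MeasurableSet A)
    (hν : ν A ≠ ∞) : ∀ᵐ ω ∂P, pointCount T A ω ≠ ⊤ := by
  have hm := measurable_pointCount h.measurable hA
  have : ∀ᵐ x ∂(P.map (pointCount T A)), x ≠ ⊤ := by
    rw [h.map_pointCount A hA hν, ae_map_iff Measurable.of_discrete.aemeasurable .of_discrete]
    simp
  exact ae_of_ae_map hm.aemeasurable this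

lemma lintegral_negExp_pointCount (h : HasPoissonCounts T ν P) {A : Set E} (hA : MeasurableSet A)
    (hν : ν A ≠ ∞) (c : ℝ≥0∞) :
    ∫⁻ ω, negExp (c * (pointCount T A ω : ℝ≥0∞)) ∂P = negExp ((1 - negExp c) * ν A) := by
  have hm := measurable_pointCount h.measurable hA
  rw [← lintegral_map (f := fun n : ℕ∞ => negExp (c * (n : ℝ≥0∞))) .of_discrete hm,
    h.map_pointCount A hA hν, lintegral_map .of_discrete .of_discrete]
  simp only [ENat.toENNReal_coe]
  rw [lintegral_negExp_poissonMeasure, ENNReal.coe_toNNReal hν]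

lemma lintegral_negExp_sum (h : HasPoissonCounts T ν P) {ι : Type*} [Fintype ι] {A : ι → Set E}
    (hA : ∀ i, MeasurableSet (A i)) (hν : ∀ i, ν (A i) ≠ ∞)
    (hd : Pairwise (fun i j => Disjoint (A i) (A j))) (c : ι → ℝ≥0∞) :
    ∫⁻ ω, negExp (∑ i, c i * (pointCount T (A i) ω : ℝ≥0∞)) ∂P =
      negExp (∑ i, (1 - negExp (c i)) * ν (A i)) := by
  simp_rw [negExp_sum]
  rw [lintegral_prod_eq_prod_lintegral_of_indepFun Finset.univ
    (fun i ω => negExp (c i * (pointCount T (A i) ω : ℝ≥0∞)))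
    ((h.indep hA hν hd).comp (fun i n => negExp (c i * (n : ℝ≥0∞))) fun i => .of_discrete)
    fun i => (Measurable.of_discrete (f := fun n : ℕ∞ => negExp (c i * (n : ℝ≥0∞)))).comp
      (measurable_pointCount h.measurable (hA i))]
  exact Finset.prod_congr rfl fun i _ => h.lintegral_negExp_pointCount (hA i) (hν i) (c i)

end HasPoissonCounts

/-- The sum of the values of a simple function at the points, in terms of counts. -/
lemma tsum_simpleFunc_eq {Ω : Type*} {T : ℕ → Ω → E} (u : SimpleFunc E ℝ≥0∞) (ω : Ω) :
    ∑' n, u (T n ω) = ∑ c : {c // c ∈ u.range.erase 0}, (c : ℝ≥0∞) *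
      (pointCount T (u ⁻¹' {(c : ℝ≥0∞)}) ω : ℝ≥0∞) := by
  -- The value `0` is left out because its level set may have infinite intensity, where the count is
  -- not controlled.
  have h1 : ∀ x, u x = ∑ c ∈ u.range.erase 0, (u ⁻¹' {c}).indicator (fun _ => c) x := by
    intro x
    by_cases hx : u x = 0
    · rw [Finset.sum_eq_zero, hx]
      intro c hc
      rw [Set.indicator_of_notMem]
      intro hxc
      exact (Finset.mem_erase.1 hc).1 (hxc.symm.trans hx)
    · rw [Finset.sum_eq_single (u x)]
      · simp
      · intro c _ hc
        exact Set.indicator_of_notMem (fun h => hc h.symm) _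
      · intro h
        exact absurd (Finset.mem_erase.2 ⟨hx, u.mem_range_self x⟩) h
  rw [Finset.sum_coe_sort (u.range.erase 0)
    (fun c => c * (pointCount T (u ⁻¹' {c}) ω : ℝ≥0∞))]
  simp_rw [fun n => h1 (T n ω)]
  rw [Summable.tsum_finsetSum fun _ _ => ENNReal.summable]
  exact Finset.sum_congr rfl fun c _ => tsum_indicator_eq_pointCount T _ c ω

lemma pairwise_disjoint_preimage_range (u : SimpleFunc E ℝ≥0∞) :
    Pairwise (fun i j : {c // c ∈ u.range.erase 0} =>
      Disjoint (u ⁻¹' {(i : ℝ≥0∞)}) (u ⁻¹' {(j : ℝ≥0∞)})) := fun i j hij =>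
  Disjoint.preimage _ (by simpa using fun h => hij (Subtype.ext h))

/-! ### Laplace functional of a process with Poisson counts -/

namespace HasPoissonCounts

lemma lintegral_negExp_tsum_simpleFunc (h : HasPoissonCounts T ν P) (u : SimpleFunc E ℝ≥0∞)
    (hu : ∀ c ≠ 0, ν (u ⁻¹' {c}) ≠ ∞) :
    ∫⁻ ω, negExp (∑' n, u (T n ω)) ∂P = negExp (∫⁻ x, (1 - negExp (u x)) ∂ν) := by
  simp_rw [tsum_simpleFunc_eq]
  rw [h.lintegral_negExp_sum (fun c => u.measurableSet_preimage _)
    (fun c => hu _ (Finset.mem_erase.1 c.2).1) (pairwise_disjoint_preimage_range u)]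
  congr 1
  have := (u.map fun c => 1 - negExp c).lintegral_eq_lintegral ν
  rw [SimpleFunc.map_lintegral] at this
  simp only [SimpleFunc.map_apply] at this
  rw [this, Finset.sum_coe_sort (u.range.erase 0) (fun c => (1 - negExp c) * ν (u ⁻¹' {c}))]
  refine Finset.sum_erase _ ?_
  simp [negExp_zero]

/-- The Laplace functional of a Poisson process. -/
theorem lintegral_negExp_tsum [SigmaFinite ν] [IsProbabilityMeasure P]
    (h : HasPoissonCounts T ν P) {u : E → ℝ≥0∞} (hu : Measurable u) :
    ∫⁻ ω, negExp (∑' n, u (T n ω)) ∂P = negExp (∫⁻ x, (1 - negExp (u x)) ∂ν) := by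
  -- Cutting off to sets of finite intensity makes every nonzero level set finite, as the
  -- simple-function case requires, and still increases to `u`.
  set v : ℕ → SimpleFunc E ℝ≥0∞ := fun k => (SimpleFunc.eapprox u k).restrict (spanningSets ν k)
  have hv (k x) : v k x = (spanningSets ν k).indicator (SimpleFunc.eapprox u k) x :=
    SimpleFunc.restrict_apply _ (measurableSet_spanningSets ν k) x
  have hmono : Monotone fun k => (v k : E → ℝ≥0∞) := by
    intro i j hij x
    simp only [hv]
    exact (Set.indicator_le_indicator_of_subset (monotone_spanningSets ν hij)
      (fun _ => zero_le) x).trans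
      (Set.indicator_le_indicator (SimpleFunc.monotone_eapprox u hij x))
  have hsup (x) : ⨆ k, v k x = u x := by
    apply le_antisymm
    · refine iSup_le fun k => ?_
      rw [hv]
      refine (Set.indicator_le_self' (fun _ _ => zero_le) x).trans ?_
      rw [← SimpleFunc.iSup_eapprox_apply hu x]
      exact le_iSup (fun k => SimpleFunc.eapprox u k x) k
    · rw [← SimpleFunc.iSup_eapprox_apply hu x]
      refine iSup_le fun k => ?_
      obtain ⟨m, hm⟩ := Set.mem_iUnion.1 (iUnion_spanningSets ν ▸ Set.mem_univ x)
      refine le_trans ?_ (le_iSup (fun k => v k x) (max k m))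
      rw [hv, Set.indicator_of_mem (monotone_spanningSets ν (le_max_right k m) hm)]
      exact SimpleFunc.monotone_eapprox u (le_max_left k m) x
  have hlim (x) : Tendsto (fun k => v k x) atTop (𝓝 (u x)) := by
    rw [← hsup x]
    exact tendsto_atTop_iSup fun i j hij => hmono hij x
  have key (k) := h.lintegral_negExp_tsum_simpleFunc (v k) fun c hc => by
    refine ne_top_of_le_ne_top (measure_spanningSets_lt_top ν k).ne (measure_mono ?_)
    intro x hx
    by_contra hxs
    apply hc
    rw [← show v k x = c from hx, hv, Set.indicator_of_notMem hxs]
  have hL : Tendsto (fun k => ∫⁻ ω, negExp (∑' n, v k (T n ω)) ∂P) atTop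
      (𝓝 (∫⁻ ω, negExp (∑' n, u (T n ω)) ∂P)) := by
    refine tendsto_lintegral_of_dominated_convergence (fun _ => 1)
      (fun k => measurable_negExp.comp (Measurable.tsum fun n =>
        (v k).measurable.comp (h.measurable n))) (fun k => ae_of_all _ fun ω => negExp_le_one _)
      (by simp) (ae_of_all _ fun ω => ?_)
    refine (continuous_negExp.tendsto _).comp ?_
    simp only [← lintegral_count]
    exact lintegral_tendsto_of_tendsto_of_monotone
      (fun k => (measurable_from_top (f := fun n => v k (T n ω))).aemeasurable)
      (ae_of_all _ fun n i j hij => hmono hij _) (ae_of_all _ fun n => hlim _)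
  have hR : Tendsto (fun k => negExp (∫⁻ x, (1 - negExp (v k x)) ∂ν)) atTop
      (𝓝 (negExp (∫⁻ x, (1 - negExp (u x)) ∂ν))) := by
    refine (continuous_negExp.tendsto _).comp ?_
    refine lintegral_tendsto_of_tendsto_of_monotone
      (fun k => (measurable_const.sub (measurable_negExp.comp (v k).measurable)).aemeasurable)
      (ae_of_all _ fun x i j hij => tsub_le_tsub_left (antitone_negExp (hmono hij x)) _)
      (ae_of_all _ fun x => ?_)
    exact ENNReal.Tendsto.sub tendsto_const_nhds ((continuous_negExp.tendsto _).comp (hlim x))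
      (Or.inl ENNReal.one_ne_top)
  simp_rw [key] at hL
  exact tendsto_nhds_unique hL hR

end HasPoissonCounts

end Counts

end MANET

namespace MANET

open Filter Topology

/-! ### Measures on a cube are determined by their moments -/

/-- A monomial, as a continuous function on the cube. -/
noncomputable def cubeMonomial {ι : Type*} [Fintype ι] (m : ι → ℕ) :
    BoundedContinuousFunction (ι → unitInterval) ℝ :=
  BoundedContinuousFunction.mkOfCompact ⟨fun x => ∏ i, (x i : ℝ) ^ m i, by fun_prop⟩

lemma cubeMonomial_apply {ι : Type*} [Fintype ι] (m : ι → ℕ) (x : ι → unitInterval) :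
    cubeMonomial m x = ∏ i, (x i : ℝ) ^ m i := rfl

/-- The monomials on the cube. -/
noncomputable def cubeMonomials (ι : Type*) [Fintype ι] :
    Submonoid (BoundedContinuousFunction (ι → unitInterval) ℝ) where
  carrier := Set.range cubeMonomial
  one_mem' := ⟨0, by ext x; simp [cubeMonomial_apply]⟩
  mul_mem' := by
    rintro _ _ ⟨m, rfl⟩ ⟨n, rfl⟩
    exact ⟨m + n, by ext x; simp [cubeMonomial_apply, pow_add, Finset.prod_mul_distrib]⟩

/-- The monomials are closed under products, so their span is an algebra; it contains the
coordinates and hence separates points. Finite measures that agree on such an algebra coincide. -/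
theorem ext_of_integral_prod_pow {ι : Type*} [Fintype ι] {μ μ' : Measure (ι → unitInterval)}
    [IsFiniteMeasure μ] [IsFiniteMeasure μ']
    (h : ∀ m : ι → ℕ, ∫ x, ∏ i, (x i : ℝ) ^ m i ∂μ = ∫ x, ∏ i, (x i : ℝ) ^ m i ∂μ') : μ = μ' := by
  classical
  let A : StarSubalgebra ℝ (BoundedContinuousFunction (ι → unitInterval) ℝ) :=
    { Algebra.adjoin ℝ (cubeMonomials ι : Set (BoundedContinuousFunction (ι → unitInterval) ℝ)) with
      star_mem' := fun {a} ha => by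
        have : star a = a := by ext x; simp
        rwa [this] }
  refine ext_of_forall_mem_subalgebra_integral_eq_of_polish (𝕜 := ℝ) (A := A) ?_ ?_
  · intro x y hxy
    obtain ⟨i, hi⟩ := Function.ne_iff.1 hxy
    refine ⟨fun z => (z i : ℝ), ⟨⟨fun z => (z i : ℝ), by fun_prop⟩, ?_, rfl⟩, by
      simpa [Subtype.ext_iff] using hi⟩
    refine ⟨cubeMonomial (Pi.single i 1), Algebra.subset_adjoin ⟨_, rfl⟩, ?_⟩
    ext z
    simp [cubeMonomial_apply, Pi.single_apply]
  · have hint (f : BoundedContinuousFunction (ι → unitInterval) ℝ)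
        (κ : Measure (ι → unitInterval)) [IsFiniteMeasure κ] : Integrable (fun x => f x) κ :=
      f.integrable κ
    intro g hg
    have hg' : g ∈ Submodule.span ℝ
        (cubeMonomials ι : Set (BoundedContinuousFunction (ι → unitInterval) ℝ)) := by
      have : g ∈ Subalgebra.toSubmodule (Algebra.adjoin ℝ
        (cubeMonomials ι : Set (BoundedContinuousFunction (ι → unitInterval) ℝ))) := hg
      rwa [Algebra.adjoin_eq_span, Submonoid.closure_eq] at this
    clear hg
    induction hg' using Submodule.span_induction with
    | mem g hgm =>
      obtain ⟨m, rfl⟩ := hgm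
      exact h m
    | zero => simp
    | add f g _ _ hf hg =>
      simp only [BoundedContinuousFunction.coe_add, Pi.add_apply]
      rw [integral_add (hint f μ) (hint g μ), integral_add (hint f μ') (hint g μ'), hf, hg]
    | smul c f _ hf =>
      simp only [BoundedContinuousFunction.coe_smul]
      rw [integral_smul, integral_smul, hf]

/-! ### Poisson counts from the Laplace functional -/

/-- `exp (-n)` as a point of the unit interval. -/
noncomputable def negExpUnit (n : ℕ∞) : unitInterval :=
  ⟨(negExp (n : ℝ≥0∞)).toReal, ENNReal.toReal_nonneg,
    ENNReal.toReal_le_of_le_ofReal one_pos.le (by simpa using negExp_le_one n)⟩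

lemma injective_negExpUnit : Function.Injective negExpUnit := fun m n h => by
  have h1 := congrArg Subtype.val h
  simp only [negExpUnit] at h1
  rw [ENNReal.toReal_eq_toReal_iff' (negExp_ne_top _) (negExp_ne_top _)] at h1
  exact_mod_cast injective_negExp h1

lemma negExpUnit_pow (n : ℕ∞) (m : ℕ) :
    (negExpUnit n : ℝ) ^ m = (negExp (m * (n : ℝ≥0∞))).toReal := by
  rw [negExp_natCast_mul, ENNReal.toReal_pow, negExpUnit]

section

variable {Ω E : Type*} [MeasurableSpace Ω] [MeasurableSpace E] {T : ℕ → Ω → E} {P : Measure Ω}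
  {ν : Measure E}

/-- The moment of order `m` of the vector `exp (-N i)` is the Laplace functional at `∑ i, m i * 1_{A
i}`, so the Laplace functional fixes all moments on the cube. Only finite test functions `u` are
needed, since the multiplicities `m i` are natural numbers. -/
lemma map_pointCount_pi_of_laplace [IsProbabilityMeasure P] (hT : ∀ n, Measurable (T n))
    (h : ∀ u : E → ℝ≥0∞, Measurable u → (∀ x, u x ≠ ∞) →
      ∫⁻ ω, negExp (∑' n, u (T n ω)) ∂P = negExp (∫⁻ x, (1 - negExp (u x)) ∂ν))
    {k : ℕ} {A : Fin k → Set E} (hA : ∀ i, MeasurableSet (A i)) (hν : ∀ i, ν (A i) ≠ ∞)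
    (hd : Pairwise (fun i j => Disjoint (A i) (A j))) :
    P.map (fun ω i => pointCount T (A i) ω) =
      Measure.pi fun i => (poissonMeasure (ν (A i)).toNNReal).map fun n : ℕ => (n : ℕ∞) := by
  have hN : Measurable fun ω i => pointCount T (A i) ω :=
    measurable_pi_lambda _ fun i => measurable_pointCount hT (hA i)
  have hpi : ∀ i, IsProbabilityMeasure
      ((poissonMeasure (ν (A i)).toNNReal).map fun n : ℕ => (n : ℕ∞)) := fun i =>
    Measure.isProbabilityMeasure_map Measurable.of_discrete.aemeasurable
  set F : (Fin k → ℕ∞) → Fin k → unitInterval := fun n i => negExpUnit (n i)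
  have hF : Measurable F := measurable_pi_lambda _ fun i =>
    (Measurable.of_discrete (f := negExpUnit)).comp (measurable_pi_apply i)
  have hFi : Function.Injective F := fun m n hmn =>
    funext fun i => injective_negExpUnit (congrFun hmn i)
  -- The encoding by `exp (-n)` is injective and the count vectors are countable, so nothing is lost
  -- by comparing the image measures on the cube.
  suffices hmap : (P.map (fun ω i => pointCount T (A i) ω)).map F =
      (Measure.pi fun i =>
        (poissonMeasure (ν (A i)).toNNReal).map fun n : ℕ => (n : ℕ∞)).map F by
    ext s hs
    have hs' : MeasurableSet (F '' s) := (s.to_countable.image F).measurableSet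
    rw [← hFi.preimage_image s, ← Measure.map_apply hF hs', hmap, Measure.map_apply hF hs']
  have : IsProbabilityMeasure (P.map fun ω i => pointCount T (A i) ω) :=
    Measure.isProbabilityMeasure_map hN.aemeasurable
  refine ext_of_integral_prod_pow fun m => ?_
  have hprod : Measurable fun x : Fin k → unitInterval => ∏ i, (x i : ℝ) ^ m i := by fun_prop
  rw [integral_map hF.aemeasurable hprod.aestronglyMeasurable,
    integral_map hF.aemeasurable hprod.aestronglyMeasurable,
    integral_map hN.aemeasurable (f := fun n => ∏ i, (F n i : ℝ) ^ m i)
      (hprod.comp hF).aestronglyMeasurable]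
  have hR := integral_fintype_prod_eq_prod (𝕜 := ℝ)
    (μ := fun i => (poissonMeasure (ν (A i)).toNNReal).map fun n : ℕ => (n : ℕ∞))
    (fun i n => (negExpUnit n : ℝ) ^ m i)
  simp only [F]
  rw [hR]
  have h1 : ∀ i, ∫ n, (negExpUnit n : ℝ) ^ m i
      ∂((poissonMeasure (ν (A i)).toNNReal).map fun n : ℕ => (n : ℕ∞)) =
      (negExp ((1 - negExp (m i)) * ν (A i))).toReal := by
    intro i
    rw [integral_map Measurable.of_discrete.aemeasurable
      Measurable.of_discrete.aestronglyMeasurable]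
    simp_rw [negExpUnit_pow]
    rw [integral_toReal Measurable.of_discrete.aemeasurable
      (ae_of_all _ fun n => (negExp_ne_top _).lt_top)]
    simp only [ENat.toENNReal_coe]
    rw [lintegral_negExp_poissonMeasure, ENNReal.coe_toNNReal (hν i)]
  have hmi : ∀ i, Measurable ((A i).indicator fun _ => (m i : ℝ≥0∞)) :=
    fun i => measurable_const.indicator (hA i)
  have h2 : ∀ ω, ∏ i, (negExpUnit (pointCount T (A i) ω) : ℝ) ^ m i =
      (negExp (∑' n, ∑ i, (A i).indicator (fun _ => (m i : ℝ≥0∞)) (T n ω))).toReal := by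
    intro ω
    simp_rw [negExpUnit_pow, ← ENNReal.toReal_prod, ← negExp_sum, ← tsum_indicator_eq_pointCount]
    rw [Summable.tsum_finsetSum fun _ _ => ENNReal.summable]
  have hum : Measurable fun x => ∑ i, (A i).indicator (fun _ => (m i : ℝ≥0∞)) x :=
    Finset.measurable_fun_sum _ fun i _ => hmi i
  simp_rw [h1, h2]
  rw [integral_toReal, h _ hum, ← ENNReal.toReal_prod, ← negExp_sum]
  · congr 2
    -- By disjointness at most one summand is nonzero at `x`, which is what lets `1 - exp (-·)` pass
    -- through the sum.
    have h3 : ∀ x, 1 - negExp (∑ i, (A i).indicator (fun _ => (m i : ℝ≥0∞)) x) =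
        ∑ i, (A i).indicator (fun _ => 1 - negExp (m i)) x := by
      intro x
      by_cases hx : ∃ i, x ∈ A i
      · obtain ⟨i, hi⟩ := hx
        have hj : ∀ j, j ≠ i → x ∉ A j := fun j hj hxj =>
          Set.disjoint_left.1 (hd hj) hxj hi
        rw [Finset.sum_eq_single i, Finset.sum_eq_single i, Set.indicator_of_mem hi,
          Set.indicator_of_mem hi]
        all_goals simp +contextual [hj]
      · push Not at hx
        simp [hx, negExp_zero]
    simp_rw [h3]
    rw [lintegral_finsetSum _ fun i _ => measurable_const.indicator (hA i)]
    exact Finset.sum_congr rfl fun i _ => lintegral_indicator_const (hA i) _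
  · intro x
    rw [Ne, ENNReal.sum_eq_top]
    rintro ⟨i, -, hi⟩
    by_cases hx : x ∈ A i <;> simp [hx] at hi
  · exact (measurable_negExp.comp (Measurable.tsum fun n => hum.comp (hT n))).aemeasurable
  · exact ae_of_all _ fun ω => (negExp_ne_top _).lt_top

theorem hasPoissonCounts_of_laplace [IsProbabilityMeasure P] (hT : ∀ n, Measurable (T n))
    (h : ∀ u : E → ℝ≥0∞, Measurable u → (∀ x, u x ≠ ∞) →
      ∫⁻ ω, negExp (∑' n, u (T n ω)) ∂P = negExp (∫⁻ x, (1 - negExp (u x)) ∂ν)) :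
    HasPoissonCounts T ν P := by
  have hp : ∀ r : ℝ≥0, IsProbabilityMeasure ((poissonMeasure r).map fun n : ℕ => (n : ℕ∞)) :=
    fun r => Measure.isProbabilityMeasure_map Measurable.of_discrete.aemeasurable
  have hone : ∀ A : Set E, MeasurableSet A → ν A ≠ ∞ →
      P.map (pointCount T A) = (poissonMeasure (ν A).toNNReal).map (fun n : ℕ => (n : ℕ∞)) := by
    intro A hA hν
    have h1 := map_pointCount_pi_of_laplace hT h (k := 1) (A := fun _ => A) (fun _ => hA)
      (fun _ => hν) (fun i j hij => absurd (Subsingleton.elim i j) hij)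
    have h2 := congrArg (Measure.map (Function.eval 0)) h1
    rw [Measure.map_map (measurable_pi_apply 0)
      (measurable_pi_lambda _ fun i => measurable_pointCount hT hA),
      (measurePreserving_eval (fun _ : Fin 1 =>
        (poissonMeasure (ν A).toNNReal).map fun n : ℕ => (n : ℕ∞)) 0).map_eq] at h2
    exact h2
  refine ⟨hT, hone, fun k A hA hν hd => ?_⟩
  rw [iIndepFun_iff_map_fun_eq_pi_map fun i => (measurable_pointCount hT (hA i)).aemeasurable,
    map_pointCount_pi_of_laplace hT h hA hν hd]
  congr 1
  ext1 i
  exact (hone _ (hA i) (hν i)).symm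

/-- The marking theorem. -/
theorem HasPoissonCounts.prodMk [SigmaFinite ν] [IsProbabilityMeasure P]
    (hT : HasPoissonCounts T ν P) {F : Type*} [MeasurableSpace F] {ρ : ℕ → Ω → F} {κ : Measure F}
    [IsProbabilityMeasure κ] (hρm : ∀ n, Measurable (ρ n)) (hρ : ∀ n, HasLaw (ρ n) κ P)
    (hρi : iIndepFun ρ P) (hTρ : IndepFun (fun ω n => T n ω) (fun ω n => ρ n ω) P) :
    HasPoissonCounts (fun n ω => (T n ω, ρ n ω)) (ν.prod κ) P := by
  refine hasPoissonCounts_of_laplace (fun n => (hT.measurable n).prodMk (hρm n)) fun u hu hut => ?_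
  have hTm : Measurable fun ω n => T n ω := measurable_pi_lambda _ hT.measurable
  have hρm' : Measurable fun ω n => ρ n ω := measurable_pi_lambda _ hρm
  set φ : E → ℝ≥0∞ := fun t => ∫⁻ r, negExp (u (t, r)) ∂κ
  have hφ : Measurable φ := (measurable_negExp.comp hu).lintegral_prod_right'
  have hsec : ∀ t, Measurable fun r => negExp (u (t, r)) := fun t =>
    measurable_negExp.comp (hu.comp measurable_prodMk_left)
  have hφ1 : ∀ t, φ t ≤ 1 := fun t =>
    (lintegral_mono fun r => negExp_le_one _).trans (by simp)
  -- Finiteness of `u` enters here: `φ` must be positive for it to equal `exp (-v)` with a finite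
  -- `v` given by the real logarithm.
  have hφ0 : ∀ t, φ t ≠ 0 := by
    intro t h0
    rw [lintegral_eq_zero_iff (hsec t)] at h0
    obtain ⟨r, hr⟩ := h0.exists
    exact hut (t, r) (injective_negExp (by simpa [negExp_top] using hr))
  set v : E → ℝ≥0∞ := fun t => ENNReal.ofReal (-Real.log (φ t).toReal)
  have hv : Measurable v := (Real.measurable_log.comp hφ.ennreal_toReal).neg.ennreal_ofReal
  have hvφ : ∀ t, negExp (v t) = φ t := by
    intro t
    have htop := ne_top_of_le_ne_top ENNReal.one_ne_top (hφ1 t)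
    have hpos : 0 < (φ t).toReal := ENNReal.toReal_pos (hφ0 t) htop
    have hle : (φ t).toReal ≤ 1 :=
      ENNReal.toReal_le_of_le_ofReal one_pos.le (by simpa using hφ1 t)
    rw [negExp_ofReal (neg_nonneg.2 (Real.log_nonpos hpos.le hle)), neg_neg, Real.exp_log hpos,
      ENNReal.ofReal_toReal htop]
  -- For frozen positions, integrating out the independent marks replaces `u` by `v`: marking
  -- reduces to the unmarked Laplace functional at `v`.
  have hinner : ∀ t : ℕ → E,
      ∫⁻ ω, negExp (∑' n, u (t n, ρ n ω)) ∂P = negExp (∑' n, v (t n)) := by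
    intro t
    have hum : ∀ n, Measurable fun ω => u (t n, ρ n ω) := fun n =>
      hu.comp (measurable_const.prodMk (hρm n))
    have hL : Tendsto (fun N => ∫⁻ ω, negExp (∑ n ∈ Finset.range N, u (t n, ρ n ω)) ∂P) atTop
        (𝓝 (∫⁻ ω, negExp (∑' n, u (t n, ρ n ω)) ∂P)) :=
      tendsto_lintegral_of_dominated_convergence (fun _ => 1)
        (fun N => measurable_negExp.comp (Finset.measurable_fun_sum _ fun n _ => hum n))
        (fun N => ae_of_all _ fun ω => negExp_le_one _) (by simp)
        (ae_of_all _ fun ω => (continuous_negExp.tendsto _).comp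
          (ENNReal.tendsto_nat_tsum fun n => u (t n, ρ n ω)))
    have hR : Tendsto (fun N => negExp (∑ n ∈ Finset.range N, v (t n))) atTop
        (𝓝 (negExp (∑' n, v (t n)))) :=
      (continuous_negExp.tendsto _).comp (ENNReal.tendsto_nat_tsum fun n => v (t n))
    refine tendsto_nhds_unique (hL.congr fun N => ?_) hR
    simp_rw [negExp_sum]
    rw [lintegral_prod_eq_prod_lintegral_of_indepFun (Finset.range N)
      (fun n ω => negExp (u (t n, ρ n ω)))
      (hρi.comp (fun n r => negExp (u (t n, r))) fun n => hsec (t n))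
      fun n => measurable_negExp.comp (hum n)]
    refine Finset.prod_congr rfl fun n _ => ?_
    rw [hvφ, (hρ n).lintegral_comp (hsec (t n)).aemeasurable]
  have hG : Measurable fun p : (ℕ → E) × (ℕ → F) => negExp (∑' n, u (p.1 n, p.2 n)) :=
    measurable_negExp.comp (Measurable.tsum fun n => hu.comp
      (((measurable_pi_apply n).comp measurable_fst).prodMk
        ((measurable_pi_apply n).comp measurable_snd)))
  have hV : Measurable fun t : ℕ → E => negExp (∑' n, v (t n)) :=
    measurable_negExp.comp (Measurable.tsum fun n => hv.comp (measurable_pi_apply n))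
  have : IsProbabilityMeasure (P.map fun ω n => ρ n ω) :=
    Measure.isProbabilityMeasure_map hρm'.aemeasurable
  calc ∫⁻ ω, negExp (∑' n, u (T n ω, ρ n ω)) ∂P
      = ∫⁻ p, negExp (∑' n, u (p.1 n, p.2 n))
          ∂(P.map fun ω => ((fun n => T n ω), fun n => ρ n ω)) :=
        (lintegral_map hG (hTm.prodMk hρm')).symm
    _ = ∫⁻ t, ∫⁻ r, negExp (∑' n, u (t n, r n)) ∂(P.map fun ω n => ρ n ω)
          ∂(P.map fun ω n => T n ω) := by
        rw [(indepFun_iff_map_prod_eq_prod_map_map hTm.aemeasurable hρm'.aemeasurable).1 hTρ,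
          lintegral_prod _ hG.aemeasurable]
    _ = ∫⁻ t, negExp (∑' n, v (t n)) ∂(P.map fun ω n => T n ω) := by
        refine lintegral_congr fun t => ?_
        have hGt : Measurable fun r : ℕ → F => negExp (∑' n, u (t n, r n)) :=
          measurable_negExp.comp (Measurable.tsum fun n =>
            hu.comp (measurable_const.prodMk (measurable_pi_apply n)))
        rw [lintegral_map hGt hρm', ← hinner t]
    _ = ∫⁻ ω, negExp (∑' n, v (T n ω)) ∂P := by
        rw [lintegral_map hV hTm]
    _ = negExp (∫⁻ t, (1 - φ t) ∂ν) := by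
        rw [hT.lintegral_negExp_tsum hv]
        simp_rw [hvφ]
    _ = negExp (∫⁻ x, (1 - negExp (u x)) ∂(ν.prod κ)) := by
        have hm : Measurable fun x => 1 - negExp (u x) :=
          measurable_const.sub (measurable_negExp.comp hu)
        rw [lintegral_prod _ hm.aemeasurable]
        congr 2
        ext1 t
        rw [lintegral_sub (hsec t)
          (ne_top_of_le_ne_top ENNReal.one_ne_top (hφ1 t)) (ae_of_all _ fun r => negExp_le_one _)]
        simp [φ]

end

end MANET

namespace MANET

open Filter Topology Set

/-! ### The intensity of the interference powers -/

lemma measurable_interfPower (α : ℝ) :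
    Measurable fun p : EuclideanSpace ℝ (Fin 2) × ℝ => interfPower α p.1 p.2 := by
  unfold interfPower
  fun_prop

/-- `r ^ δ` times the exponential density is `Γ(1 + δ)` times a Gamma density of shape `1 + δ`,
which integrates to `1`. -/
lemma lintegral_rpow_expMeasure {δ : ℝ} (hδ : 0 < δ) :
    ∫⁻ r, ENNReal.ofReal (r ^ δ) ∂(expMeasure 1) = ENNReal.ofReal (Real.Gamma (1 + δ)) := by
  have hΓ : 0 < Real.Gamma (1 + δ) := Real.Gamma_pos_of_pos (by linarith)
  have hm (a : ℝ) : Measurable (gammaPDF a 1) := (measurable_gammaPDFReal a 1).ennreal_ofReal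
  rw [expMeasure, gammaMeasure, lintegral_withDensity_eq_lintegral_mul _ (hm 1) (by fun_prop)]
  have h : ∀ x, (gammaPDF 1 1 * fun r => ENNReal.ofReal (r ^ δ)) x =
      ENNReal.ofReal (Real.Gamma (1 + δ)) * gammaPDF (1 + δ) 1 x := by
    intro x
    rw [Pi.mul_apply]
    rcases lt_or_ge x 0 with hx | hx
    · simp [gammaPDF_of_neg hx]
    · rw [gammaPDF_of_nonneg hx, gammaPDF_of_nonneg hx, ← ENNReal.ofReal_mul (by positivity),
        ← ENNReal.ofReal_mul hΓ.le]
      congr 1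
      simp
      field_simp
  simp_rw [h]
  rw [lintegral_const_mul _ (hm _), lintegral_gammaPDF_eq_one (by linarith) one_pos, mul_one]

lemma sigmaFinite_ofReal_smul {E : Type*} [MeasurableSpace E] (c : ℝ) (ν : Measure E)
    [SigmaFinite ν] : SigmaFinite (ENNReal.ofReal c • ν) :=
  inferInstanceAs (SigmaFinite (c.toNNReal • ν))

/-- The upper tail of `μ` is `y ↦ C * y ^ (-δ)`. -/
def HasPowerTail (μ : Measure ℝ≥0∞) (C δ : ℝ) : Prop :=
  ∀ y : ℝ, 0 < y → μ (Ioi (ENNReal.ofReal y)) = ENNReal.ofReal (C * y ^ (-δ))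

/-- The intensity measure of the interference powers. -/
noncomputable def powerIntensity (α lam : ℝ) : Measure ℝ≥0∞ :=
  ((ENNReal.ofReal lam • (volume : Measure (EuclideanSpace ℝ (Fin 2)))).prod (expMeasure 1)).map
    fun p => interfPower α p.1 p.2

lemma ofReal_lt_interfPower_iff {α y r : ℝ} (hα : 0 < α) (hy : 0 < y) (hr : 0 < r)
    (x : EuclideanSpace ℝ (Fin 2)) :
    ENNReal.ofReal y < interfPower α x r ↔ x ∈ Metric.ball 0 ((r / y) ^ α⁻¹) \ {0} := by
  rw [interfPower, ENNReal.ofReal_lt_ofReal_iff_of_nonneg hy.le]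
  simp only [Set.mem_sdiff, Metric.mem_ball, dist_zero_right, mem_singleton_iff]
  by_cases hx : x = 0
  -- At the origin `0 ^ (-α)` is `0` by convention, so the origin contributes no power and is
  -- removed from the ball; it is a null set.
  · simp [hx, Real.zero_rpow (neg_ne_zero.2 hα.ne'), hy.le]
  · have hn : 0 < ‖x‖ := norm_pos_iff.2 hx
    have hna : 0 < ‖x‖ ^ α := Real.rpow_pos_of_pos hn α
    simp only [hx, not_false_eq_true, and_true]
    rw [Real.rpow_neg hn.le, Real.lt_rpow_inv_iff_of_pos hn.le (by positivity) hα, inv_mul_eq_div,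
      lt_div_iff₀ hna, lt_div_iff₀ hy, mul_comm]

/-- For fading `r` the interferers stronger than `y` fill a punctured disc of area `π * (r / y) ^
δ`; the exponential moment of `r ^ δ` supplies the Gamma factor. -/
lemma hasPowerTail_powerIntensity {α lam : ℝ} (hα : 0 < α) (hlam : 0 < lam) :
    HasPowerTail (powerIntensity α lam) (lam * Real.pi * Real.Gamma (1 + delta α)) (delta α) := by
  intro y hy
  have hδ : 0 < delta α := div_pos two_pos hα
  have : IsProbabilityMeasure (expMeasure 1) := isProbabilityMeasure_expMeasure one_pos
  have hs : MeasurableSet ((fun p : EuclideanSpace ℝ (Fin 2) × ℝ => interfPower α p.1 p.2) ⁻¹'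
      Ioi (ENNReal.ofReal y)) := measurable_interfPower α measurableSet_Ioi
  have := sigmaFinite_ofReal_smul lam (volume : Measure (EuclideanSpace ℝ (Fin 2)))
  rw [powerIntensity, Measure.map_apply (measurable_interfPower α) measurableSet_Ioi,
    Measure.prod_apply_symm hs]
  have hpos : ∀ᵐ r ∂(expMeasure 1), 0 < r := by
    rw [expMeasure, gammaMeasure, ae_withDensity_iff (f := gammaPDF 1 1)
      (measurable_gammaPDFReal 1 1).ennreal_ofReal]
    filter_upwards [(measure_eq_zero_iff_ae_notMem (s := {(0 : ℝ)})).1 (by simp)] with r hr0 hr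
    by_contra h
    exact hr (gammaPDF_of_neg (lt_of_le_of_ne (not_lt.1 h) hr0))
  have hsec : ∀ᵐ r ∂(expMeasure 1), (ENNReal.ofReal lam •
      (volume : Measure (EuclideanSpace ℝ (Fin 2)))) ((fun x => (x, r)) ⁻¹'
        ((fun p : EuclideanSpace ℝ (Fin 2) × ℝ => interfPower α p.1 p.2) ⁻¹'
          Ioi (ENNReal.ofReal y))) =
      ENNReal.ofReal (lam * Real.pi * y ^ (-delta α)) * ENNReal.ofReal (r ^ delta α) := by
    filter_upwards [hpos] with r hr
    have : (fun x => (x, r)) ⁻¹' ((fun p : EuclideanSpace ℝ (Fin 2) × ℝ =>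
        interfPower α p.1 p.2) ⁻¹' Ioi (ENNReal.ofReal y)) =
        Metric.ball 0 ((r / y) ^ α⁻¹) \ {0} := by
      ext x
      exact ofReal_lt_interfPower_iff hα hy hr x
    rw [this, Measure.smul_apply, measure_sdiff_null (by simp), EuclideanSpace.volume_ball_fin_two,
      smul_eq_mul, ← ENNReal.ofReal_pow (by positivity), ← ENNReal.ofReal_mul (by positivity),
      ← ENNReal.ofReal_mul hlam.le, ← ENNReal.ofReal_mul (by positivity)]
    congr 1
    rw [← Real.rpow_natCast, ← Real.rpow_mul (by positivity), Real.div_rpow hr.le hy.le,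
      Real.rpow_neg hy.le, delta]
    have : α⁻¹ * ((2 : ℕ) : ℝ) = 2 / α := by push_cast; ring
    rw [this]
    field_simp
  rw [lintegral_congr_ae hsec, lintegral_const_mul _ (by fun_prop), lintegral_rpow_expMeasure hδ,
    ← ENNReal.ofReal_mul (by positivity)]
  congr 1
  ring

/-! ### Truncated moments -/

/-- The identity, truncated to `0` above the level `x`. -/
noncomputable def truncate (x : ℝ) : ℝ≥0∞ → ℝ≥0∞ := (Iic (ENNReal.ofReal x)).indicator id

lemma measurable_truncate (x : ℝ) : Measurable (truncate x) :=
  measurable_id.indicator measurableSet_Iic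

lemma truncate_le (x : ℝ) (y : ℝ≥0∞) : truncate x y ≤ ENNReal.ofReal x :=
  indicator_le' (fun _ h => h) (fun _ _ => zero_le) y

lemma lt_truncate_iff {x s : ℝ} (y : ℝ≥0∞) :
    ENNReal.ofReal s < truncate x y ↔ y ∈ Ioc (ENNReal.ofReal s) (ENNReal.ofReal x) := by
  by_cases hy : y ≤ ENNReal.ofReal x <;> simp [truncate, hy]

namespace HasPowerTail

variable {μ : Measure ℝ≥0∞} {C δ : ℝ}

lemma Ioc (h : HasPowerTail μ C δ) (hC : 0 ≤ C) {x y : ℝ} (hx : 0 < x) (hxy : x ≤ y) :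
    μ (Ioc (ENNReal.ofReal x) (ENNReal.ofReal y)) =
      ENNReal.ofReal (C * x ^ (-δ) - C * y ^ (-δ)) := by
  have hy := hx.trans_le hxy
  rw [← Ioi_sdiff_Ioi, measure_sdiff (Ioi_subset_Ioi (ENNReal.ofReal_le_ofReal hxy))
    measurableSet_Ioi.nullMeasurableSet (by rw [h y hy]; exact ENNReal.ofReal_ne_top), h x hx,
    h y hy, ENNReal.ofReal_sub _ (by positivity)]

/-- Layer-cake formula: at height `s ≤ x` the superlevel set is `(s, x]`, of intensity `C * s ^ (-δ)
- C * x ^ (-δ)`. The condition `δ < p` gives integrability at `0`. The exponents `p = 1` and `p = 2`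
yield the mean and variance of the sum of the powers up to `x`. -/
lemma lintegral_truncate_rpow (h : HasPowerTail μ C δ) (hδ : 0 < δ) (hC : 0 ≤ C) {x p : ℝ}
    (hx : 0 < x) (hp : δ < p) :
    ∫⁻ y, truncate x y ^ p ∂μ = ENNReal.ofReal (C * δ / (p - δ) * x ^ (p - δ)) := by
  have hp0 : 0 < p := hδ.trans hp
  have h1 : ∀ y, truncate x y ^ p = ENNReal.ofReal ((truncate x y).toReal ^ p) := by
    intro y
    rw [← ENNReal.ofReal_rpow_of_nonneg ENNReal.toReal_nonneg hp0.le, ENNReal.ofReal_toReal]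
    exact ne_top_of_le_ne_top ENNReal.ofReal_ne_top (truncate_le x y)
  simp_rw [h1]
  rw [lintegral_rpow_eq_lintegral_meas_lt_mul μ (ae_of_all _ fun y => ENNReal.toReal_nonneg)
    (measurable_truncate x).ennreal_toReal.aemeasurable hp0]
  have h2 : ∀ s ∈ Ioi (0 : ℝ), μ {y | s < (truncate x y).toReal} * ENNReal.ofReal (s ^ (p - 1)) =
      (Iic x).indicator
        (fun s => ENNReal.ofReal (C * (s ^ (p - 1 - δ) - x ^ (-δ) * s ^ (p - 1)))) s := by
    intro s hs
    have hs0 : 0 < s := hs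
    have hset : {y | s < (truncate x y).toReal} = Set.Ioc (ENNReal.ofReal s) (ENNReal.ofReal x) := by
      ext y
      rw [← lt_truncate_iff, mem_ofPred_eq, ENNReal.ofReal_lt_iff_lt_toReal hs0.le
        (ne_top_of_le_ne_top ENNReal.ofReal_ne_top (truncate_le x y))]
    rw [hset]
    by_cases hsx : s ≤ x
    · rw [indicator_of_mem (mem_Iic.2 hsx), h.Ioc hC hs0 hsx, ← ENNReal.ofReal_mul
        (sub_nonneg.2 (mul_le_mul_of_nonneg_left
          (Real.rpow_le_rpow_of_nonpos hs0 hsx (by linarith)) hC)),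
        show p - 1 - δ = -δ + (p - 1) by ring, Real.rpow_add hs0]
      congr 1
      ring
    · rw [indicator_of_notMem (by simpa using hsx), Ioc_eq_empty, measure_empty, zero_mul]
      rw [not_lt]
      exact ENNReal.ofReal_le_ofReal (not_le.1 hsx).le
  rw [setLIntegral_congr_fun measurableSet_Ioi h2, lintegral_indicator measurableSet_Iic,
    Measure.restrict_restrict measurableSet_Iic, inter_comm, Ioi_inter_Iic]
  have hi1 : IntervalIntegrable (fun s : ℝ => s ^ (p - 1 - δ)) volume 0 x :=
    intervalIntegral.intervalIntegrable_rpow' (by linarith)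
  have hi2 : IntervalIntegrable (fun s : ℝ => x ^ (-δ) * s ^ (p - 1)) volume 0 x :=
    (intervalIntegral.intervalIntegrable_rpow' (by linarith)).const_mul _
  rw [← ofReal_integral_eq_lintegral_ofReal]
  · rw [← intervalIntegral.integral_of_le hx.le, intervalIntegral.integral_const_mul,
      intervalIntegral.integral_sub hi1 hi2, intervalIntegral.integral_const_mul,
      integral_rpow (Or.inl (by linarith)), integral_rpow (Or.inl (by linarith)),
      ← ENNReal.ofReal_mul hp0.le]
    congr 1
    rw [show p - 1 - δ + 1 = p - δ by ring, show p - 1 + 1 = p by ring,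
      Real.zero_rpow (by linarith), Real.zero_rpow hp0.ne', show p - δ = p + -δ by ring,
      Real.rpow_add hx]
    have : p + -δ ≠ 0 := by linarith
    field_simp
    ring
  · exact ((intervalIntegrable_iff_integrableOn_Ioc_of_le hx.le).1 (hi1.sub hi2)).const_mul C
  · filter_upwards [ae_restrict_mem measurableSet_Ioc] with s hs
    have hs0 : 0 < s := hs.1
    have : x ^ (-δ) * s ^ (p - 1) ≤ s ^ (p - 1 - δ) := by
      rw [show p - 1 - δ = -δ + (p - 1) by ring, Real.rpow_add hs0]
      gcongr ?_ * _
      exact Real.rpow_le_rpow_of_nonpos hs0 hs.2 (by linarith)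
    exact mul_nonneg hC (sub_nonneg.2 this)

end HasPowerTail

end MANET

namespace MANET

open Filter Topology Set

/-! ### Mean and variance of Poisson counts -/

lemma hasSum_poisson_mul (r : ℝ≥0) :
    HasSum (fun n : ℕ => Real.exp (-r) * r ^ n / n.factorial * n) r := by
  rw [← hasSum_nat_add_iff' 1]
  have h := (hasSum_one_poissonMeasure r).mul_left (r : ℝ)
  simp only [mul_one] at h
  have e : (fun n : ℕ => Real.exp (-r) * (r : ℝ) ^ (n + 1) / (n + 1).factorial * (n + 1 : ℕ)) =
      fun n : ℕ => r * (Real.exp (-r) * r ^ n / n.factorial) := by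
    ext n
    rw [Nat.factorial_succ]
    push_cast
    field_simp
    ring
  rw [e]
  simpa using h

lemma hasSum_poisson_mul_sq (r : ℝ≥0) :
    HasSum (fun n : ℕ => Real.exp (-r) * r ^ n / n.factorial * (n : ℝ) ^ 2) (r + r ^ 2 : ℝ) := by
  have h2 : HasSum (fun n : ℕ => Real.exp (-r) * r ^ n / n.factorial * (n * (n - 1)))
      ((r : ℝ) ^ 2) := by
    rw [← hasSum_nat_add_iff' 2]
    have h := (hasSum_one_poissonMeasure r).mul_left ((r : ℝ) ^ 2)
    simp only [mul_one] at h
    have e : (fun n : ℕ => Real.exp (-r) * (r : ℝ) ^ (n + 2) / (n + 2).factorial *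
        ((n + 2 : ℕ) * ((n + 2 : ℕ) - 1))) =
        fun n : ℕ => r ^ 2 * (Real.exp (-r) * r ^ n / n.factorial) := by
      ext n
      rw [Nat.factorial_succ, Nat.factorial_succ]
      push_cast
      field_simp
      ring
    rw [e]
    simpa [Finset.sum_range_succ] using h
  convert (hasSum_poisson_mul r).add h2 using 1
  ext n
  ring

lemma memLp_two_poissonMeasure (r : ℝ≥0) : MemLp (fun n : ℕ => (n : ℝ)) 2 (poissonMeasure r) := by
  rw [memLp_two_iff_integrable_sq Measurable.of_discrete.aestronglyMeasurable,
    integrable_poissonMeasure_iff]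
  simpa using (hasSum_poisson_mul_sq r).summable

lemma integral_natCast_poissonMeasure (r : ℝ≥0) : ∫ n, (n : ℝ) ∂(poissonMeasure r) = r := by
  rw [integral_poissonMeasure]
  simpa using (hasSum_poisson_mul r).tsum_eq

lemma variance_natCast_poissonMeasure (r : ℝ≥0) :
    variance (fun n : ℕ => (n : ℝ)) (poissonMeasure r) = r := by
  rw [variance_eq_sub (memLp_two_poissonMeasure r), integral_natCast_poissonMeasure]
  simp only [Pi.pow_apply]
  rw [integral_poissonMeasure]
  simp only [smul_eq_mul]
  rw [(hasSum_poisson_mul_sq r).tsum_eq]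
  ring

section

variable {Ω E : Type*} [MeasurableSpace Ω] [MeasurableSpace E] {T : ℕ → Ω → E} {P : Measure Ω}
  {ν : Measure E}

/-- The number of points in a set, as a real number. -/
noncomputable def realCount {Ω E : Type*} (T : ℕ → Ω → E) (A : Set E) (ω : Ω) : ℝ :=
  (pointCount T A ω : ℝ≥0∞).toReal

namespace HasPoissonCounts

lemma memLp_realCount (h : HasPoissonCounts T ν P) {A : Set E} (hA : MeasurableSet A)
    (hν : ν A ≠ ∞) : MemLp (realCount T A) 2 P := by
  have hm := (measurable_pointCount h.measurable hA).aemeasurable (μ := P)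
  have h1 : MemLp (fun n : ℕ∞ => (n : ℝ≥0∞).toReal) 2 (P.map (pointCount T A)) := by
    rw [h.map_pointCount A hA hν, memLp_map_measure_iff
      Measurable.of_discrete.aestronglyMeasurable Measurable.of_discrete.aemeasurable]
    exact memLp_two_poissonMeasure _
  rwa [memLp_map_measure_iff Measurable.of_discrete.aestronglyMeasurable hm] at h1

lemma integral_realCount (h : HasPoissonCounts T ν P) {A : Set E} (hA : MeasurableSet A)
    (hν : ν A ≠ ∞) : ∫ ω, realCount T A ω ∂P = (ν A).toReal := by
  have hm := (measurable_pointCount h.measurable hA).aemeasurable (μ := P)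
  have h1 : ∫ n : ℕ∞, (n : ℝ≥0∞).toReal ∂(P.map (pointCount T A)) = (ν A).toReal := by
    rw [h.map_pointCount A hA hν, integral_map Measurable.of_discrete.aemeasurable
      Measurable.of_discrete.aestronglyMeasurable]
    exact integral_natCast_poissonMeasure _
  rwa [integral_map hm Measurable.of_discrete.aestronglyMeasurable] at h1

lemma variance_realCount (h : HasPoissonCounts T ν P) {A : Set E} (hA : MeasurableSet A)
    (hν : ν A ≠ ∞) : variance (realCount T A) P = (ν A).toReal := by
  have hm := (measurable_pointCount h.measurable hA).aemeasurable (μ := P)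
  have h1 : variance (fun n : ℕ∞ => (n : ℝ≥0∞).toReal) (P.map (pointCount T A)) =
      (ν A).toReal := by
    rw [h.map_pointCount A hA hν, variance_map Measurable.of_discrete.aemeasurable
      Measurable.of_discrete.aemeasurable]
    exact variance_natCast_poissonMeasure _
  rwa [variance_map Measurable.of_discrete.aemeasurable hm] at h1

/-! ### Chebyshev's inequality for sums over a Poisson process -/

variable {u : SimpleFunc E ℝ≥0∞}

lemma _root_.MANET.measure_preimage_ne_top_of_lintegral (hfin : ∫⁻ x, u x ∂ν ≠ ∞) {c : ℝ≥0∞}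
    (hc : c ≠ 0) : ν (u ⁻¹' {c}) ≠ ∞ := by
  have h1 := mul_meas_ge_le_lintegral (μ := ν) u.measurable c
  have h2 : c * ν (u ⁻¹' {c}) ≤ c * ν {x | c ≤ u x} :=
    mul_le_mul_right (measure_mono fun x hx => (show u x = c from hx).ge) c
  exact fun h => hfin (top_le_iff.1 (by simpa [h, ENNReal.mul_top hc] using h2.trans h1))

/-- The sum is a function of the counts of the nonzero level sets of `u`, which are disjoint from
one another and from every `B i`. -/
lemma indepFun_pointCount_tsum (h : HasPoissonCounts T ν P) (hfin : ∫⁻ x, u x ∂ν ≠ ∞)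
    {ι : Type*} [Fintype ι] {B : ι → Set E} (hB : ∀ i, MeasurableSet (B i)) (hν : ∀ i, ν (B i) ≠ ∞)
    (hd : Pairwise fun i j => Disjoint (B i) (B j)) (hu0 : ∀ i, ∀ x ∈ B i, u x = 0) :
    IndepFun (fun ω i => pointCount T (B i) ω) (fun ω => ∑' n, u (T n ω)) P := by
  classical
  let J := {c // c ∈ u.range.erase 0}
  let A : J ⊕ ι → Set E := Sum.elim (fun c => u ⁻¹' {(c : ℝ≥0∞)}) B
  have hAm : ∀ i, MeasurableSet (A i) := by
    rintro (c | i)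
    · exact u.measurableSet_preimage _
    · exact hB i
  have hind : iIndepFun (fun i => pointCount T (A i)) P := by
    refine h.indep hAm ?_ ?_
    · rintro (c | i)
      · exact measure_preimage_ne_top_of_lintegral hfin (Finset.mem_erase.1 c.2).1
      · exact hν i
    · have hx : ∀ (c : J) i, Disjoint (u ⁻¹' {(c : ℝ≥0∞)}) (B i) := by
        intro c i
        rw [Set.disjoint_left]
        intro x hxc hxB
        exact (Finset.mem_erase.1 c.2).1 (hxc.symm.trans (hu0 i x hxB))
      rintro (c | i) (c' | i') hne
      · exact pairwise_disjoint_preimage_range u fun hcc => hne (by rw [hcc])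
      · exact hx c i'
      · exact (hx c' i).symm
      · exact hd fun hii => hne (by rw [hii])
  let SJ : Finset (J ⊕ ι) := Finset.univ.filter fun i => i.isLeft
  let SI : Finset (J ⊕ ι) := Finset.univ.filter fun i => i.isRight
  have hdis : Disjoint SI SJ := by
    rw [Finset.disjoint_left]
    rintro (c | i) <;> simp [SI, SJ]
  have h2 := hind.indepFun_finset SI SJ hdis fun i => measurable_pointCount h.measurable (hAm i)
  have h3 := h2.comp
    (φ := fun y : SI → ℕ∞ => fun i : ι => y ⟨Sum.inr i, by simp [SI]⟩)
    (ψ := fun y : SJ → ℕ∞ => ∑ c : J, (c : ℝ≥0∞) * (y ⟨Sum.inl c, by simp [SJ]⟩ : ℝ≥0∞))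
    (measurable_pi_lambda _ fun i => measurable_pi_apply _)
    (Finset.measurable_fun_sum _ fun c _ => measurable_const.mul
      (Measurable.comp (g := fun n : ℕ∞ => (n : ℝ≥0∞)) .of_discrete (measurable_pi_apply _)))
  refine h3.congr (ae_of_all _ fun ω => rfl) (ae_of_all _ fun ω => ?_)
  exact (tsum_simpleFunc_eq u ω).symm

/-- The sum is a combination of independent Poisson counts with the values `c` as coefficients. A
Poisson count has equal mean and variance, so the sum has mean `∫ u` and variance `∫ u ^ 2`, and
Chebyshev's inequality applies. -/
lemma measure_lt_tsum_simpleFunc_le [IsProbabilityMeasure P] (h : HasPoissonCounts T ν P)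
    (hfin : ∫⁻ x, u x ∂ν ≠ ∞) (hut : ∀ x, u x ≠ ∞) {s : ℝ} (hs : (∫⁻ x, u x ∂ν).toReal < s) :
    P {ω | ENNReal.ofReal s < ∑' n, u (T n ω)} ≤
      (∫⁻ x, u x ^ 2 ∂ν) / ENNReal.ofReal ((s - (∫⁻ x, u x ∂ν).toReal) ^ 2) := by
  classical
  let J := {c // c ∈ u.range.erase 0}
  have hJt : ∀ c : J, (c : ℝ≥0∞) ≠ ∞ := by
    intro c
    obtain ⟨x, hx⟩ := SimpleFunc.mem_range.1 (Finset.mem_erase.1 c.2).2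
    rw [← hx]
    exact hut x
  have hA : ∀ c : J, MeasurableSet (u ⁻¹' {(c : ℝ≥0∞)}) := fun c => u.measurableSet_preimage _
  have hν : ∀ c : J, ν (u ⁻¹' {(c : ℝ≥0∞)}) ≠ ∞ := fun c =>
    measure_preimage_ne_top_of_lintegral hfin (Finset.mem_erase.1 c.2).1
  set m := (∫⁻ x, u x ∂ν).toReal
  set S : Ω → ℝ := ∑ c : J, fun ω => (c : ℝ≥0∞).toReal * realCount T (u ⁻¹' {(c : ℝ≥0∞)}) ω
  have hLp : ∀ c : J, MemLp (fun ω => (c : ℝ≥0∞).toReal *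
      realCount T (u ⁻¹' {(c : ℝ≥0∞)}) ω) 2 P :=
    fun c => (h.memLp_realCount (hA c) (hν c)).const_mul _
  have hS : MemLp S 2 P := memLp_finsetSum' _ fun c _ => hLp c
  have hmean : ∫ ω, S ω ∂P = m := by
    have h1 : ∫⁻ x, u x ∂ν = ∑ c : J, (c : ℝ≥0∞) * ν (u ⁻¹' {(c : ℝ≥0∞)}) := by
      rw [Finset.sum_coe_sort (u.range.erase 0) (fun c => c * ν (u ⁻¹' {c})),
        u.lintegral_eq_lintegral ν, SimpleFunc.lintegral]
      exact (Finset.sum_erase _ (by simp)).symm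
    simp only [S, Finset.sum_apply]
    rw [integral_finsetSum _ fun c _ => (hLp c).integrable one_le_two]
    simp only [m]
    rw [h1, ENNReal.toReal_sum fun c _ => ENNReal.mul_ne_top (hJt c) (hν c)]
    refine Finset.sum_congr rfl fun c _ => ?_
    rw [integral_const_mul, h.integral_realCount (hA c) (hν c), ENNReal.toReal_mul]
  have hvar : ENNReal.ofReal (variance S P) = ∫⁻ x, u x ^ 2 ∂ν := by
    have h1 : ∫⁻ x, u x ^ 2 ∂ν = ∑ c : J, (c : ℝ≥0∞) ^ 2 * ν (u ⁻¹' {(c : ℝ≥0∞)}) := by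
      have := (u.map fun c => c ^ 2).lintegral_eq_lintegral ν
      rw [SimpleFunc.map_lintegral] at this
      simp only [SimpleFunc.map_apply] at this
      rw [this, Finset.sum_coe_sort (u.range.erase 0) (fun c => c ^ 2 * ν (u ⁻¹' {c}))]
      exact (Finset.sum_erase _ (by simp)).symm
    simp only [S]
    rw [IndepFun.variance_sum (fun c _ => hLp c), h1,
      ENNReal.ofReal_sum_of_nonneg fun c _ => variance_nonneg _ _]
    · refine Finset.sum_congr rfl fun c _ => ?_
      rw [variance_const_mul, h.variance_realCount (hA c) (hν c),
        ENNReal.ofReal_mul (by positivity), ENNReal.ofReal_toReal (hν c),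
        ENNReal.ofReal_pow ENNReal.toReal_nonneg, ENNReal.ofReal_toReal (hJt c)]
    · intro c _ c' _ hcc
      have hi := (h.indep hA hν (pairwise_disjoint_preimage_range u)).indepFun hcc
      exact hi.comp (φ := fun n : ℕ∞ => (c : ℝ≥0∞).toReal * (n : ℝ≥0∞).toReal)
        (ψ := fun n : ℕ∞ => (c' : ℝ≥0∞).toReal * (n : ℝ≥0∞).toReal) .of_discrete .of_discrete
  have hae : ∀ᵐ ω ∂P, ∑' n, u (T n ω) = ENNReal.ofReal (S ω) := by
    have : ∀ᵐ ω ∂P, ∀ c : J, pointCount T (u ⁻¹' {(c : ℝ≥0∞)}) ω ≠ ⊤ :=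
      ae_all_iff.2 fun c => h.ae_pointCount_ne_top (hA c) (hν c)
    filter_upwards [this] with ω hω
    rw [tsum_simpleFunc_eq]
    simp only [S, Finset.sum_apply]
    rw [ENNReal.ofReal_sum_of_nonneg (fun c _ => mul_nonneg ENNReal.toReal_nonneg
      (show 0 ≤ realCount T _ ω from ENNReal.toReal_nonneg))]
    refine Finset.sum_congr rfl fun c _ => ?_
    rw [ENNReal.ofReal_mul ENNReal.toReal_nonneg, ENNReal.ofReal_toReal (hJt c), realCount,
      ENNReal.ofReal_toReal]
    simpa using hω c
  have hpos : 0 < s - m := sub_pos.2 hs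
  rw [← hvar, ← ENNReal.ofReal_div_of_pos (by positivity)]
  refine le_trans (measure_mono_ae ?_) (meas_ge_le_variance_div_sq hS hpos)
  filter_upwards [hae] with ω hω hlt
  have hlt' : ENNReal.ofReal s < ∑' n, u (T n ω) := hlt
  rw [hω] at hlt'
  have : s < S ω := (ENNReal.ofReal_lt_ofReal_iff_of_nonneg
    (ENNReal.toReal_nonneg.trans hs.le)).1 hlt'
  change s - m ≤ |S ω - ∫ ω, S ω ∂P|
  rw [hmean]
  exact (sub_le_sub_right this.le m).trans (le_abs_self _)

/-- Chebyshev's inequality for the sum of `f` over the points of a Poisson process, on an event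
that depends only on the points outside the support of `f`. -/
theorem measure_inter_lt_tsum_le [IsProbabilityMeasure P] (h : HasPoissonCounts T ν P)
    {f : E → ℝ≥0∞} (hf : Measurable f) {ι : Type*} [Fintype ι] {B : ι → Set E}
    (hB : ∀ i, MeasurableSet (B i)) (hν : ∀ i, ν (B i) ≠ ∞)
    (hd : Pairwise fun i j => Disjoint (B i) (B j)) (hf0 : ∀ i, ∀ x ∈ B i, f x = 0)
    (D : Set (ι → ℕ∞)) {m v s : ℝ} (hm : ∫⁻ x, f x ∂ν ≤ ENNReal.ofReal m) (hm0 : 0 ≤ m)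
    (hv : ∫⁻ x, f x ^ 2 ∂ν ≤ ENNReal.ofReal v) (hs : m < s) :
    P ({ω | (fun i => pointCount T (B i) ω) ∈ D} ∩ {ω | ENNReal.ofReal s < ∑' n, f (T n ω)}) ≤
      P {ω | (fun i => pointCount T (B i) ω) ∈ D} * ENNReal.ofReal (v / (s - m) ^ 2) := by
  set A : Set Ω := {ω | (fun i => pointCount T (B i) ω) ∈ D}
  set u : ℕ → SimpleFunc E ℝ≥0∞ := SimpleFunc.eapprox f
  have hle : ∀ k x, u k x ≤ f x := fun k x => by
    rw [← SimpleFunc.iSup_eapprox_apply hf x]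
    exact le_iSup (fun k => SimpleFunc.eapprox f k x) k
  have hmono : ∀ i j, i ≤ j → ∀ x, u i x ≤ u j x := fun i j hij x =>
    SimpleFunc.monotone_eapprox f hij x
  -- The strict inequality matters: a supremum exceeds `s` exactly when some approximation does, so
  -- the event is an increasing union.
  have hunion : A ∩ {ω | ENNReal.ofReal s < ∑' n, f (T n ω)} =
      ⋃ k, A ∩ {ω | ENNReal.ofReal s < ∑' n, u k (T n ω)} := by
    ext ω
    have hsup : ∑' n, f (T n ω) = ⨆ k, ∑' n, u k (T n ω) := by
      simp only [← lintegral_count]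
      rw [← lintegral_iSup (fun k => measurable_from_top)
        fun i j hij n => hmono i j hij (T n ω)]
      exact lintegral_congr fun n => (SimpleFunc.iSup_eapprox_apply hf _).symm
    simp only [mem_inter_iff, mem_ofPred_eq, mem_iUnion, hsup, lt_iSup_iff, exists_and_left]
  have hdir : Monotone fun k => A ∩ {ω | ENNReal.ofReal s < ∑' n, u k (T n ω)} := by
    intro i j hij ω hω
    exact ⟨hω.1, lt_of_lt_of_le hω.2 (ENNReal.tsum_le_tsum fun n => hmono i j hij _)⟩
  rw [hunion, hdir.measure_iUnion]
  refine iSup_le fun k => ?_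
  have hmk : ∫⁻ x, u k x ∂ν ≤ ENNReal.ofReal m := (lintegral_mono (hle k)).trans hm
  have hfin : ∫⁻ x, u k x ∂ν ≠ ∞ := ne_top_of_le_ne_top ENNReal.ofReal_ne_top hmk
  have hmk' : (∫⁻ x, u k x ∂ν).toReal ≤ m := ENNReal.toReal_le_of_le_ofReal hm0 hmk
  have hind := h.indepFun_pointCount_tsum (u := u k) hfin hB hν hd fun i x hx =>
    le_antisymm ((hle k x).trans (hf0 i x hx).le) zero_le
  have hmul := hind.measure_inter_preimage_eq_mul D (Ioi (ENNReal.ofReal s))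
    (D.to_countable.measurableSet) measurableSet_Ioi
  refine (le_of_eq hmul).trans (mul_le_mul_right ?_ _)
  refine (h.measure_lt_tsum_simpleFunc_le hfin
    (fun x => (SimpleFunc.eapprox_lt_top f k x).ne) (hmk'.trans_lt hs)).trans ?_
  have hpos : 0 < s - m := sub_pos.2 hs
  rw [ENNReal.ofReal_div_of_pos (by positivity)]
  gcongr
  exact (lintegral_mono fun x => pow_le_pow_left₀ zero_le (hle k x) 2).trans hv

end HasPoissonCounts

end

end MANET

namespace MANET

open Filter Topology Set

/-! ### Residual interference, path by path -/

section Deterministic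

variable {L : ℕ} {J : ℕ → ℝ≥0∞} {x : ℝ≥0∞}

/-- Besides `n` itself, the interferers stronger than `n` also exceed `x`, and there are at least `L
- 1` of them. -/
lemma le_encard_of_mem_residual {n : ℕ} (hn : n ∈ residual L J) (hx : x < J n) :
    (L : ℕ∞) ≤ {m | x < J m}.encard := by
  have hn' : n ∉ stronger J n := by simp [stronger]
  refine le_trans hn ?_
  rw [← encard_insert_of_notMem hn']
  refine encard_le_encard (insert_subset hx ?_)
  rintro m (hm | hm)
  · exact hx.trans hm
  · exact hx.trans_eq hm.1.symm

lemma exists_mem_residual (hL : 1 ≤ L) (hfin : {m | x < J m}.Finite)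
    (h : (L : ℕ∞) ≤ {m | x < J m}.encard) : ∃ n ∈ residual L J, x < J n := by
  have hne : {m | x < J m}.Nonempty := by
    rw [nonempty_iff_ne_empty]
    intro h0
    rw [h0, encard_empty] at h
    have : L = 0 := by simpa using h
    omega
  -- The witness is the weakest interferer above `x`. Among equal powers the largest index is
  -- weakest, hence the dual order in the second coordinate.
  obtain ⟨n, hn, hmin⟩ := hfin.toFinset.exists_min_image
    (fun m => toLex (J m, OrderDual.toDual m)) (by simpa using hne)
  rw [Finite.mem_toFinset] at hn
  refine ⟨n, h.trans ?_, hn⟩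
  have hsub : {m | x < J m} ⊆ insert n (stronger J n) := by
    intro m hm
    have := hmin m (by simpa using hm)
    rw [Prod.Lex.toLex_le_toLex] at this
    rcases eq_or_ne m n with rfl | hne
    · exact mem_insert _ _
    · refine mem_insert_of_mem _ ?_
      rcases this with h1 | ⟨h1, h2⟩
      · exact Or.inl h1
      · exact Or.inr ⟨h1.symm, lt_of_le_of_ne (OrderDual.toDual_le_toDual.1 h2) hne⟩
  exact (encard_le_encard hsub).trans (encard_insert_le _ _)

lemma lt_iSup_residual_iff (hL : 1 ≤ L) (hfin : {m | x < J m}.Finite) :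
    x < ⨆ n ∈ residual L J, J n ↔ (L : ℕ∞) ≤ {m | x < J m}.encard := by
  simp only [lt_iSup_iff, exists_prop]
  exact ⟨fun ⟨n, hn, hx⟩ => le_encard_of_mem_residual hn hx, exists_mem_residual hL hfin⟩

lemma le_residualPower {n : ℕ} (hn : n ∈ residual L J) : J n ≤ residualPower L J := by
  have := ENNReal.le_tsum (f := (residual L J).indicator J) n
  rwa [indicator_of_mem hn] at this

lemma iSup_residual_le_residualPower : ⨆ n ∈ residual L J, J n ≤ residualPower L J :=
  iSup₂_le fun _ hn => le_residualPower hn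

/-- With fewer than `L` powers above `x'`, no surviving power exceeds `x'`. Those in the bin `(x,
x']` are each bounded by `x'`; the others are counted by `truncate`. -/
lemma residualPower_le {x x' : ℝ} (h : {m | ENNReal.ofReal x' < J m}.encard < L) :
    residualPower L J ≤ ∑' n, truncate x (J n) + ENNReal.ofReal x' *
      ({m | J m ∈ Ioc (ENNReal.ofReal x) (ENNReal.ofReal x')}.encard : ℝ≥0∞) := by
  have h1 := tsum_indicator_eq_pointCount (Ω := Unit) (fun n _ => J n)
    (Ioc (ENNReal.ofReal x) (ENNReal.ofReal x')) (ENNReal.ofReal x') ()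
  rw [pointCount] at h1
  rw [← h1, ← ENNReal.tsum_add]
  refine ENNReal.tsum_le_tsum fun n => ?_
  refine indicator_apply_le' (fun hn => ?_) (fun _ => zero_le)
  have hn' : J n ≤ ENNReal.ofReal x' := by
    by_contra hlt
    exact absurd (le_encard_of_mem_residual hn (not_le.1 hlt)) (not_le.2 h)
  by_cases hx : J n ≤ ENNReal.ofReal x
  · simp [truncate, hx]
  · simp only [truncate, mem_Iic, hx, not_false_eq_true, indicator_of_notMem, zero_add]
    have hmem : J n ∈ Ioc (ENNReal.ofReal x) (ENNReal.ofReal x') := ⟨not_le.1 hx, hn'⟩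
    rw [indicator_of_mem hmem]
    exact hn'

lemma iSup_residual_ne_top (hJ : ∀ n, J n ≠ ∞) (hfin : {m | 1 < J m}.Finite) :
    ⨆ n ∈ residual L J, J n ≠ ∞ := by
  have hle : ⨆ n ∈ residual L J, J n ≤ 1 + ∑ n ∈ hfin.toFinset, J n := by
    refine iSup₂_le fun n _ => ?_
    by_cases hn : 1 < J n
    · exact (Finset.single_le_sum (fun _ _ => zero_le) (by simpa using hn)).trans le_add_self
    · exact (not_lt.1 hn).trans le_self_add
  exact ne_top_of_le_ne_top (ENNReal.add_ne_top.2 ⟨ENNReal.one_ne_top,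
    ENNReal.sum_ne_top.2 fun n _ => hJ n⟩) hle

end Deterministic

/-! ### Measurability -/

section Measurability

variable (L : ℕ)

lemma measurableSet_mem_residual (n : ℕ) :
    MeasurableSet {J : ℕ → ℝ≥0∞ | n ∈ residual L J} := by
  have h : Measurable fun J : ℕ → ℝ≥0∞ => (stronger J n).encard :=
    measurable_encard_setOf (p := fun m (J : ℕ → ℝ≥0∞) => J n < J m ∨ (J m = J n ∧ m < n))
      fun m => (measurableSet_lt (measurable_pi_apply n) (measurable_pi_apply m)).union
        ((measurableSet_eq_fun (measurable_pi_apply m) (measurable_pi_apply n)).inter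
          (MeasurableSet.const _))
  exact h (t := {k : ℕ∞ | (L : ℕ∞) ≤ k + 1}) .of_discrete

lemma measurable_residualPower : Measurable (residualPower L) := by
  refine Measurable.tsum fun n => ?_
  have : (fun J : ℕ → ℝ≥0∞ => (residual L J).indicator J n) =
      {J : ℕ → ℝ≥0∞ | n ∈ residual L J}.indicator fun J => J n := by
    ext J
    simp [indicator]
  rw [this]
  exact (measurable_pi_apply n).indicator (measurableSet_mem_residual L n)

lemma measurable_iSup_residual :
    Measurable fun J : ℕ → ℝ≥0∞ => ⨆ n ∈ residual L J, J n := by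
  refine Measurable.iSup fun n => ?_
  have : (fun J : ℕ → ℝ≥0∞ => ⨆ _ : n ∈ residual L J, J n) =
      {J : ℕ → ℝ≥0∞ | n ∈ residual L J}.indicator fun J => J n := by
    ext J
    by_cases h : n ∈ residual L J <;> simp [h]
  rw [this]
  exact (measurable_pi_apply n).indicator (measurableSet_mem_residual L n)

end Measurability

/-! ### Poisson tails -/

/-- The derivative of the Poisson distribution function in its mean telescopes to `-exp (-y) * y ^
(L - 1) / (L - 1)!`, the negative of the normalized incomplete gamma integrand. -/
lemma lowerGamma_natCast (L : ℕ) (hL : 1 ≤ L) (x : ℝ) :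
    1 / Real.Gamma L * lowerGamma L x =
      1 - ∑ k ∈ Finset.range L, Real.exp (-x) * x ^ k / k.factorial := by
  obtain ⟨n, rfl⟩ : ∃ n, L = n + 1 := ⟨L - 1, by omega⟩
  have hd : ∀ y : ℝ, HasDerivAt
      (fun y => ∑ k ∈ Finset.range (n + 1), Real.exp (-y) * y ^ k / k.factorial)
      (-(Real.exp (-y) * y ^ n / n.factorial)) y := by
    intro y
    have he : HasDerivAt (fun y => Real.exp (-y)) (-Real.exp (-y)) y := by
      simpa using (hasDerivAt_neg y).exp
    induction n with
    | zero => simpa using he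
    | succ n ih =>
      simp_rw [Finset.sum_range_succ _ (n + 1)]
      have h1 := (he.mul (hasDerivAt_pow (n + 1) y)).div_const ((n + 1).factorial : ℝ)
      refine ((ih (by omega)).add h1).congr_deriv ?_
      rw [Nat.factorial_succ]
      push_cast
      field_simp
      ring
  have hc : Continuous fun t : ℝ => -(Real.exp (-t) * t ^ n / n.factorial) := by fun_prop
  have hint := intervalIntegral.integral_eq_sub_of_hasDerivAt (a := 0) (b := x)
    (fun y _ => hd y) (hc.intervalIntegrable 0 x)
  have h0 : ∑ k ∈ Finset.range (n + 1), Real.exp (-(0 : ℝ)) * (0 : ℝ) ^ k / k.factorial = 1 := by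
    rw [Finset.sum_range_succ']
    simp
  rw [h0, intervalIntegral.integral_neg] at hint
  have hlg : lowerGamma (n + 1 : ℕ) x =
      n.factorial * ∫ t in (0 : ℝ)..x, Real.exp (-t) * t ^ n / n.factorial := by
    rw [lowerGamma, ← intervalIntegral.integral_const_mul]
    refine intervalIntegral.integral_congr fun t _ => ?_
    have : ((n + 1 : ℕ) : ℝ) - 1 = n := by push_cast; ring
    simp only [this, Real.rpow_natCast]
    have := Nat.factorial_pos n
    field_simp
  have hf : (n.factorial : ℝ) ≠ 0 := by positivity
  rw [hlg, Nat.cast_succ, Real.Gamma_nat_eq_factorial]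
  field_simp
  linarith

lemma poissonMeasure_real_lt (r : ℝ≥0) (L : ℕ) :
    (poissonMeasure r).real {n | n < L} =
      ∑ k ∈ Finset.range L, Real.exp (-r) * r ^ k / k.factorial := by
  have : {n : ℕ | n < L} = (Finset.range L : Set ℕ) := by ext; simp
  rw [this, ← sum_measureReal_singleton]
  exact Finset.sum_congr rfl fun k _ => poissonMeasure_real_singleton r k

/-- From `exp (-r) ≥ 1 - r` one gets `1 - exp (-r) * (1 + r) ≤ r ^ 2`. The quadratic order makes the
errors of all bins vanish with the mesh. -/
lemma poissonMeasure_two_le (r : ℝ≥0) : (poissonMeasure r) {n | 2 ≤ n} ≤ ENNReal.ofReal (r ^ 2) := by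
  have : {n : ℕ | 2 ≤ n} = {n | n < 2}ᶜ := by ext n; simp; omega
  rw [this, ← ofReal_measureReal, probReal_compl_eq_one_sub .of_discrete, poissonMeasure_real_lt]
  refine ENNReal.ofReal_le_ofReal ?_
  simp only [Finset.sum_range_succ, Finset.range_zero, Finset.sum_empty]
  have h1 := Real.add_one_le_exp (-(r : ℝ))
  have h2 := r.coe_nonneg
  simp
  nlinarith

section

variable {Ω E : Type*} [MeasurableSpace Ω] [MeasurableSpace E] {T : ℕ → Ω → E} {P : Measure Ω}
  {ν : Measure E}

namespace HasPoissonCounts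

lemma measure_pointCount_lt (h : HasPoissonCounts T ν P) {A : Set E} (hA : MeasurableSet A)
    (hν : ν A ≠ ∞) (L : ℕ) : P {ω | pointCount T A ω < L} = ENNReal.ofReal
      (∑ k ∈ Finset.range L, Real.exp (-(ν A).toReal) * (ν A).toReal ^ k / k.factorial) := by
  have h1 : P.map (pointCount T A) {n | n < L} = P {ω | pointCount T A ω < L} :=
    Measure.map_apply (measurable_pointCount h.measurable hA) .of_discrete
  rw [← h1, h.map_pointCount A hA hν, Measure.map_apply .of_discrete .of_discrete]
  have : (fun n : ℕ => (n : ℕ∞)) ⁻¹' {n | n < L} = {n | n < L} := by ext; simp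
  rw [this, ← ofReal_measureReal, poissonMeasure_real_lt]
  rfl

lemma measure_two_le_pointCount (h : HasPoissonCounts T ν P) {A : Set E} (hA : MeasurableSet A)
    (hν : ν A ≠ ∞) : P {ω | 2 ≤ pointCount T A ω} ≤ ENNReal.ofReal ((ν A).toReal ^ 2) := by
  have h1 : P.map (pointCount T A) {n | 2 ≤ n} = P {ω | 2 ≤ pointCount T A ω} :=
    Measure.map_apply (measurable_pointCount h.measurable hA) .of_discrete
  rw [← h1, h.map_pointCount A hA hν, Measure.map_apply .of_discrete .of_discrete]
  have : (fun n : ℕ => (n : ℕ∞)) ⁻¹' {n | 2 ≤ n} = {n | 2 ≤ n} := by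
    ext n
    simp only [mem_preimage, mem_ofPred_eq]
    exact_mod_cast Iff.rfl
  rw [this]
  exact poissonMeasure_two_le _

end HasPoissonCounts

end

end MANET

namespace MANET

open Filter Topology Set

/-! ### The conditional Chebyshev bound -/

/-- The level `t`, minus the primary power `g`, minus the mean of the powers below `g`. -/
noncomputable def levelMargin (C δ t g : ℝ) : ℝ := t - g - C * δ / (1 - δ) * g ^ (1 - δ)

/-- The Chebyshev bound for the probability that the powers below `g` sum up to `t - g`. -/
noncomputable def levelBound (C δ t g : ℝ) : ℝ :=
  if 0 < levelMargin C δ t g then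
    min (C * δ / (2 - δ) * g ^ (2 - δ) / levelMargin C δ t g ^ 2) 1
  else 1

section LevelBound

variable {C δ : ℝ}

lemma levelBound_le_one (C δ t g : ℝ) : levelBound C δ t g ≤ 1 := by
  rw [levelBound]
  split_ifs
  exacts [min_le_right _ _, le_rfl]

lemma measurable_levelMargin (C δ : ℝ) :
    Measurable fun p : ℝ × ℝ => levelMargin C δ p.1 p.2 := by
  unfold levelMargin
  fun_prop

lemma measurable_levelBound (C δ : ℝ) :
    Measurable fun p : ℝ × ℝ => levelBound C δ p.1 p.2 := by
  have := measurable_levelMargin C δ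
  unfold levelBound
  refine Measurable.ite (measurableSet_lt measurable_const this) ?_ measurable_const
  fun_prop

/-- The level is approached from below, so a nonpositive margin stays nonpositive and continuity at
zero margin is not needed. -/
lemma tendsto_levelBound (C δ g t : ℝ) {h : ℕ → ℝ} (hh : Tendsto h atTop (𝓝 0))
    (hh0 : ∀ n, 0 ≤ h n) :
    Tendsto (fun n => levelBound C δ (t - h n) g) atTop (𝓝 (levelBound C δ t g)) := by
  have hm : Tendsto (fun n => levelMargin C δ (t - h n) g) atTop (𝓝 (levelMargin C δ t g)) := by
    unfold levelMargin
    simpa using (((tendsto_const_nhds (x := t)).sub hh).sub_const g).sub_const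
      (C * δ / (1 - δ) * g ^ (1 - δ))
  by_cases h0 : 0 < levelMargin C δ t g
  · have he : ∀ᶠ n in atTop, levelBound C δ (t - h n) g =
        min (C * δ / (2 - δ) * g ^ (2 - δ) / levelMargin C δ (t - h n) g ^ 2) 1 := by
      filter_upwards [hm.eventually_const_lt h0] with n hn
      rw [levelBound, if_pos hn]
    rw [tendsto_congr' he, levelBound, if_pos h0]
    exact (tendsto_const_nhds.div (hm.pow 2) (by positivity)).min tendsto_const_nhds
  · have he : ∀ n, levelBound C δ (t - h n) g = 1 := by
      intro n
      rw [levelBound, if_neg]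
      have : levelMargin C δ (t - h n) g ≤ levelMargin C δ t g := by
        unfold levelMargin
        linarith [hh0 n]
      linarith
    rw [levelBound, if_neg h0]
    simp [he]

/-- Mean and variance increase with the truncation level, so the bound at the lower end `x` of a bin
is dominated by the bound at any `g` in the bin. -/
lemma le_levelBound (hC : 0 ≤ C) (hδ : 0 < δ) (hδ1 : δ < 1) {x g s t : ℝ} (hx : 0 < x)
    (hxg : x ≤ g) (hst : t - g ≤ s) :
    (if C * δ / (1 - δ) * x ^ (1 - δ) < s then
      min (C * δ / (2 - δ) * x ^ (2 - δ) / (s - C * δ / (1 - δ) * x ^ (1 - δ)) ^ 2) 1 else 1) ≤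
    levelBound C δ t g := by
  have h1 : 0 < 1 - δ := by linarith
  have h2 : 0 < 2 - δ := by linarith
  have hg := hx.trans_le hxg
  have hm : C * δ / (1 - δ) * x ^ (1 - δ) ≤ C * δ / (1 - δ) * g ^ (1 - δ) := by gcongr
  rw [levelBound]
  split_ifs with ha hb hb
  · have : levelMargin C δ t g ≤ s - C * δ / (1 - δ) * x ^ (1 - δ) := by
      unfold levelMargin
      linarith
    gcongr
  · exact min_le_right _ _
  · exfalso
    unfold levelMargin at hb
    linarith
  · exact le_rfl

end LevelBound

/-- The strongest power that is not canceled. -/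
noncomputable def primarySup (L : ℕ) (J : ℕ → ℝ≥0∞) : ℝ≥0∞ := ⨆ n ∈ residual L J, J n

lemma HasPowerTail.Ioi_ne_top {μ : Measure ℝ≥0∞} {C δ : ℝ} (hμ : HasPowerTail μ C δ) {y : ℝ}
    (hy : 0 < y) : μ (Ioi (ENNReal.ofReal y)) ≠ ∞ := by
  rw [hμ y hy]
  exact ENNReal.ofReal_ne_top

section

variable {Ω : Type*} [MeasurableSpace Ω] {P : Measure Ω}
  {μ : Measure ℝ≥0∞} {C δ : ℝ} {X : ℕ → Ω → ℝ≥0∞} {L : ℕ}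

lemma measurable_primarySup (hX : ∀ n, Measurable (X n)) (L : ℕ) :
    Measurable fun ω => primarySup L fun n => X n ω :=
  (measurable_iSup_residual L).comp (measurable_pi_lambda _ hX)

lemma HasPoissonCounts.ae_finite (h : HasPoissonCounts X μ P) (hμ : HasPowerTail μ C δ) {y : ℝ}
    (hy : 0 < y) : ∀ᵐ ω ∂P, {n | ENNReal.ofReal y < X n ω}.Finite := by
  filter_upwards [h.ae_pointCount_ne_top measurableSet_Ioi (hμ.Ioi_ne_top hy)] with ω hω
  exact encard_ne_top_iff.1 hω

lemma HasPoissonCounts.ae_lt_primarySup_iff (h : HasPoissonCounts X μ P)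
    (hμ : HasPowerTail μ C δ) (hL : 1 ≤ L) {y : ℝ} (hy : 0 < y) :
    ∀ᵐ ω ∂P, (ENNReal.ofReal y < primarySup L fun n => X n ω) ↔
      (L : ℕ∞) ≤ pointCount X (Ioi (ENNReal.ofReal y)) ω := by
  filter_upwards [h.ae_finite hμ hy] with ω hω
  exact lt_iSup_residual_iff hL hω

lemma HasPoissonCounts.measure_primarySup_le (h : HasPoissonCounts X μ P)
    (hμ : HasPowerTail μ C δ) (hC : 0 ≤ C) (hL : 1 ≤ L) {y : ℝ} (hy : 0 < y) :
    P {ω | (primarySup L fun n => X n ω) ≤ ENNReal.ofReal y} =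
      ENNReal.ofReal (1 - 1 / Real.Gamma L * lowerGamma L (C * y ^ (-δ))) := by
  have h0 : 0 ≤ C * y ^ (-δ) := by positivity
  have h1 : P {ω | (primarySup L fun n => X n ω) ≤ ENNReal.ofReal y} =
      P {ω | pointCount X (Ioi (ENNReal.ofReal y)) ω < L} := by
    refine measure_congr ?_
    filter_upwards [h.ae_lt_primarySup_iff hμ hL hy] with ω hω
    refine propext ?_
    change _ ≤ _ ↔ _ < _
    rw [← not_lt, hω, not_le]
  rw [h1, h.measure_pointCount_lt measurableSet_Ioi (hμ.Ioi_ne_top hy), hμ y hy,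
    ENNReal.toReal_ofReal h0, lowerGamma_natCast L hL, sub_sub_cancel]

/-- The intensity is infinite near `0`: the mean number of powers above `y` tends to `∞` as `y → 0`,
so fewer than `L` of them becomes impossible in the limit. -/
lemma HasPoissonCounts.ae_primarySup_pos (h : HasPoissonCounts X μ P)
    (hμ : HasPowerTail μ C δ) (hC : 0 < C) (hδ : 0 < δ) (hL : 1 ≤ L) :
    ∀ᵐ ω ∂P, 0 < primarySup L fun n => X n ω := by
  have hle : ∀ y : ℝ, 0 < y → P {ω | ¬ 0 < primarySup L fun n => X n ω} ≤ ENNReal.ofReal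
      (∑ k ∈ Finset.range L, Real.exp (-(C * y ^ (-δ))) * (C * y ^ (-δ)) ^ k / k.factorial) := by
    intro y hy
    have : {ω | ¬ 0 < primarySup L fun n => X n ω} ⊆
        {ω | (primarySup L fun n => X n ω) ≤ ENNReal.ofReal y} :=
      fun ω hω => (not_lt.1 hω).trans zero_le
    refine (measure_mono this).trans ?_
    rw [h.measure_primarySup_le hμ hC.le hL hy, lowerGamma_natCast L hL, sub_sub_cancel]
  have hlim : Tendsto (fun z : ℝ => ENNReal.ofReal
      (∑ k ∈ Finset.range L, Real.exp (-z) * z ^ k / k.factorial)) atTop (𝓝 0) := by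
    rw [← ENNReal.ofReal_zero]
    refine ENNReal.tendsto_ofReal ?_
    rw [← Finset.sum_const_zero (s := Finset.range L)]
    refine tendsto_finsetSum _ fun k _ => ?_
    have := (Real.tendsto_pow_mul_exp_neg_atTop_nhds_zero k).div_const (k.factorial : ℝ)
    rw [zero_div] at this
    refine this.congr fun z => ?_
    rw [mul_comm]
  refine le_antisymm (ge_of_tendsto hlim ?_) zero_le
  filter_upwards [eventually_gt_atTop 0] with z hz
  -- The choice `y = (z / C) ^ (-δ⁻¹)` makes the Poisson mean `C * y ^ (-δ)` equal to `z`.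
  have hzC : 0 < z / C := by positivity
  have := hle ((z / C) ^ (-δ⁻¹)) (by positivity)
  rwa [← Real.rpow_mul hzC.le, neg_mul_neg, inv_mul_cancel₀ hδ.ne', Real.rpow_one,
    mul_div_cancel₀ _ hC.ne'] at this

variable [IsProbabilityMeasure P]

/-- The Chebyshev bound when the primary power lies in a short interval. -/
lemma HasPoissonCounts.measure_bin_le (h : HasPoissonCounts X μ P) (hμ : HasPowerTail μ C δ)
    (hC : 0 ≤ C) (hδ : 0 < δ) (hδ1 : δ < 1) (hL : 1 ≤ L) {x x' e t : ℝ} (hx : 0 < x)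
    (hxx : x ≤ x') (hx' : x' - x < e) :
    P {ω | (primarySup L fun n => X n ω) ∈ Ioc (ENNReal.ofReal x) (ENNReal.ofReal x') ∧
      ENNReal.ofReal t ≤ residualPower L fun n => X n ω} ≤
    ∫⁻ ω in {ω | (primarySup L fun n => X n ω) ∈ Ioc (ENNReal.ofReal x) (ENNReal.ofReal x')},
      ENNReal.ofReal (levelBound C δ (t - e) (primarySup L fun n => X n ω).toReal) ∂P +
    ENNReal.ofReal ((C * x ^ (-δ) - C * x' ^ (-δ)) ^ 2) := by
  have hx'0 := hx.trans_le hxx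
  set G : Ω → ℝ≥0∞ := fun ω => primarySup L fun n => X n ω
  set I₁ := Ioc (ENNReal.ofReal x) (ENNReal.ofReal x')
  set I₂ := Ioi (ENNReal.ofReal x')
  have hG : Measurable G := measurable_primarySup h.measurable L
  have hI₁ : μ I₁ = ENNReal.ofReal (C * x ^ (-δ) - C * x' ^ (-δ)) := hμ.Ioc hC hx hxx
  have hI₁t : μ I₁ ≠ ∞ := by rw [hI₁]; exact ENNReal.ofReal_ne_top
  have hI₂t : μ I₂ ≠ ∞ := hμ.Ioi_ne_top hx'0
  have hI₁0 : 0 ≤ C * x ^ (-δ) - C * x' ^ (-δ) :=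
    sub_nonneg.2 (mul_le_mul_of_nonneg_left (Real.rpow_le_rpow_of_nonpos hx hxx (by linarith)) hC)
  set B : Bool → Set ℝ≥0∞ := fun b => if b then I₁ else I₂
  -- `true` is the bin and `false` the half-line above it: `D` says that the primary power is in the
  -- bin and is alone there.
  set D : Set (Bool → ℕ∞) := {y | y false < L ∧ (L : ℕ∞) ≤ y false + y true ∧ y true ≤ 1}
  set A : Set Ω := {ω | (fun b => pointCount X (B b) ω) ∈ D}
  -- The sum of the powers up to `x` must reach `t - x'`. Since `x' - x < e`, this is strictly
  -- larger than `s`, which provides the strict inequality used for Chebyshev.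
  set s := t - e - x
  set q : ℝ := if C * δ / (1 - δ) * x ^ (1 - δ) < s then
      min (C * δ / (2 - δ) * x ^ (2 - δ) / (s - C * δ / (1 - δ) * x ^ (1 - δ)) ^ 2) 1 else 1
  have hm0 : 0 ≤ C * δ / (1 - δ) * x ^ (1 - δ) := by
    have : 0 < 1 - δ := by linarith
    positivity
  have hBm : ∀ b, MeasurableSet (B b) := by
    rintro (_ | _)
    exacts [measurableSet_Ioi, measurableSet_Ioc]
  have hBt : ∀ b, μ (B b) ≠ ∞ := by
    rintro (_ | _)
    exacts [hI₂t, hI₁t]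
  have hdis : Disjoint I₁ I₂ := Set.disjoint_left.2 fun y hy hy' => not_lt.2 hy.2 hy'
  have hBd : Pairwise fun i j => Disjoint (B i) (B j) := by
    rintro (_ | _) (_ | _) hne
    exacts [absurd rfl hne, hdis.symm, hdis, absurd rfl hne]
  -- For negative `s` the event makes no claim about the sum; then `s` is below the mean, so `q = 1`
  -- and the bound is trivial.
  have hcheb : P (A ∩ {ω | 0 ≤ s → ENNReal.ofReal s < ∑' n, truncate x (X n ω)}) ≤
      P A * ENNReal.ofReal q := by
    by_cases hq : C * δ / (1 - δ) * x ^ (1 - δ) < s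
    · have hs0 : 0 ≤ s := hm0.trans hq.le
      simp only [q, if_pos hq, hs0, true_imp_iff]
      rw [ENNReal.ofReal_min, ENNReal.ofReal_one, mul_min, mul_one]
      refine le_min ?_ (measure_mono inter_subset_left)
      refine h.measure_inter_lt_tsum_le (measurable_truncate x) hBm hBt hBd ?_ D ?_ hm0 ?_ hq
      · rintro (_ | _) y hy
        · refine indicator_of_notMem (fun hyx => ?_) _
          exact absurd ((mem_Iic.1 hyx).trans (ENNReal.ofReal_le_ofReal hxx)) (not_le.2 hy)
        · exact indicator_of_notMem (fun hyx => absurd (mem_Iic.1 hyx) (not_le.2 hy.1)) _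
      · have := hμ.lintegral_truncate_rpow hδ hC hx (p := 1) hδ1
        simp only [ENNReal.rpow_one] at this
        exact this.le
      · have := hμ.lintegral_truncate_rpow hδ hC hx (p := 2) (by linarith)
        simp only [ENNReal.rpow_two] at this
        exact this.le
    · simp only [q, if_neg hq, ENNReal.ofReal_one, mul_one]
      exact measure_mono inter_subset_left
  have hiff := (h.ae_lt_primarySup_iff hμ hL hx).and (h.ae_lt_primarySup_iff hμ hL hx'0)
  have hsplit : ∀ ω, pointCount X (Ioi (ENNReal.ofReal x)) ω =
      pointCount X I₂ ω + pointCount X I₁ ω := by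
    intro ω
    rw [pointCount, pointCount, pointCount, ← encard_union_eq]
    · congr 1
      ext n
      have : ENNReal.ofReal x ≤ ENNReal.ofReal x' := ENNReal.ofReal_le_ofReal hxx
      simp only [I₁, I₂, mem_ofPred_eq, mem_union, mem_Ioi, mem_Ioc]
      constructor
      · intro hn
        rcases lt_or_ge (ENNReal.ofReal x') (X n ω) with h1 | h1
        exacts [Or.inl h1, Or.inr ⟨hn, h1⟩]
      · rintro (h1 | h1)
        exacts [this.trans_lt h1, h1.1]
    · exact Set.disjoint_left.2 fun n hn hn' => Set.disjoint_left.1 hdis hn' hn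
  have hGA : ∀ᵐ ω ∂P, G ω ∈ I₁ ∧ pointCount X I₁ ω ≤ 1 ↔ ω ∈ A := by
    filter_upwards [hiff] with ω hω
    have h1 : G ω ∈ I₁ ↔ (L : ℕ∞) ≤ pointCount X I₂ ω + pointCount X I₁ ω ∧
        pointCount X I₂ ω < L := by
      have h2 : pointCount X I₂ ω < L ↔ G ω ≤ ENNReal.ofReal x' :=
        not_le.symm.trans ((not_congr hω.2.symm).trans not_lt)
      rw [← hsplit, ← hω.1, h2]
      rfl
    rw [h1]
    change _ ↔ pointCount X I₂ ω < L ∧ (L : ℕ∞) ≤ pointCount X I₂ ω + pointCount X I₁ ω ∧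
      pointCount X I₁ ω ≤ 1
    tauto
  have hmain : P {ω | G ω ∈ I₁ ∧ ENNReal.ofReal t ≤ residualPower L fun n => X n ω} ≤
      P (A ∩ {ω | 0 ≤ s → ENNReal.ofReal s < ∑' n, truncate x (X n ω)}) +
        P {ω | 2 ≤ pointCount X I₁ ω} := by
    refine le_trans (measure_mono_ae ?_) (measure_union_le _ _)
    filter_upwards [hGA] with ω hω hmem
    obtain ⟨hGω, hR⟩ := hmem
    by_cases hU : pointCount X I₁ ω ≤ 1
    · left
      have hA := hω.1 ⟨hGω, hU⟩
      refine ⟨hA, fun hs0 => ?_⟩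
      have hV : {m | ENNReal.ofReal x' < X m ω}.encard < L := hA.1
      have hR' := hR.trans (residualPower_le (x := x) hV)
      have hU' : ENNReal.ofReal x' * ((pointCount X I₁ ω : ℕ∞) : ℝ≥0∞) ≤ ENNReal.ofReal x' := by
        calc _ ≤ ENNReal.ofReal x' * ((1 : ℕ∞) : ℝ≥0∞) := by gcongr
          _ = _ := by simp
      have hR2 : ENNReal.ofReal t ≤ ∑' n, truncate x (X n ω) + ENNReal.ofReal x' :=
        hR'.trans (add_le_add_right hU' _)
      have hst : ENNReal.ofReal s < ENNReal.ofReal (t - x') :=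
        (ENNReal.ofReal_lt_ofReal_iff_of_nonneg hs0).2 (by simp only [s]; linarith)
      refine hst.trans_le ?_
      rw [ENNReal.ofReal_sub _ hx'0.le]
      exact tsub_le_iff_right.2 hR2
    · right
      have : 1 < pointCount X I₁ ω := not_le.1 hU
      exact Order.add_one_le_of_lt this
  have hU2 : P {ω | 2 ≤ pointCount X I₁ ω} ≤
      ENNReal.ofReal ((C * x ^ (-δ) - C * x' ^ (-δ)) ^ 2) := by
    refine (h.measure_two_le_pointCount measurableSet_Ioc hI₁t).trans_eq ?_
    rw [hI₁, ENNReal.toReal_ofReal hI₁0]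
  have hAint : P A * ENNReal.ofReal q ≤ ∫⁻ ω in {ω | G ω ∈ I₁},
      ENNReal.ofReal (levelBound C δ (t - e) (G ω).toReal) ∂P := by
    have hPA : P A ≤ P {ω | G ω ∈ I₁} := measure_mono_ae (hGA.mono fun ω hω hA => (hω.2 hA).1)
    calc P A * ENNReal.ofReal q ≤ P {ω | G ω ∈ I₁} * ENNReal.ofReal q := by gcongr
      _ = ∫⁻ ω in {ω | G ω ∈ I₁}, ENNReal.ofReal q ∂P := by
          rw [setLIntegral_const, mul_comm]
      _ ≤ _ := by
          refine setLIntegral_mono' (hG measurableSet_Ioc) fun ω hω => ENNReal.ofReal_le_ofReal ?_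
          have hω' : G ω ∈ I₁ := hω
          have hGt : G ω ≠ ∞ := ne_top_of_le_ne_top ENNReal.ofReal_ne_top hω'.2
          have hxG : x ≤ (G ω).toReal := (ENNReal.ofReal_le_iff_le_toReal hGt).1 hω'.1.le
          refine le_levelBound hC hδ hδ1 hx hxG ?_
          simp only [s]
          linarith
  exact hmain.trans (add_le_add (hcheb.trans hAint) hU2)

end

end MANET

/-! ### Summing over the grid and letting the mesh tend to zero -/

namespace MANET

open Filter Topology Set

/-- Bernoulli's inequality for exponents below `1` gives a Lipschitz bound on `[a, ∞)`, so a bin of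
width `w` has intensity `O(w)`. -/
lemma rpow_neg_sub_rpow_neg_le {δ a x y : ℝ} (hδ : 0 < δ) (hδ1 : δ < 1) (ha : 0 < a) (hx : a ≤ x)
    (hxy : x ≤ y) : x ^ (-δ) - y ^ (-δ) ≤ δ * a ^ (-δ) / a * (y - x) := by
  have hx0 := ha.trans_le hx
  have hy0 := hx0.trans_le hxy
  have hs : 0 ≤ y / x - 1 := sub_nonneg.2 ((one_le_div hx0).2 hxy)
  have h1 : (1 + (y / x - 1)) ^ δ ≤ 1 + δ * (y / x - 1) :=
    rpow_one_add_le_one_add_mul_self (by linarith) hδ.le hδ1.le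
  rw [add_sub_cancel] at h1
  have h2 : 0 < (y / x) ^ δ := by positivity
  have h3 : 1 - δ * (y / x - 1) ≤ (y / x) ^ (-δ) := by
    rw [Real.rpow_neg (by positivity), ← one_div, le_div_iff₀ h2]
    have h0 : 0 ≤ δ * (y / x - 1) := by positivity
    have hq : 1 ≤ (y / x) ^ δ := Real.one_le_rpow ((one_le_div hx0).2 hxy) hδ.le
    nlinarith [mul_nonneg h0 (sub_nonneg.2 hq)]
  have h4 : y ^ (-δ) = x ^ (-δ) * (y / x) ^ (-δ) := by
    rw [← Real.mul_rpow hx0.le (by positivity), mul_div_cancel₀ _ hx0.ne']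
  have h5 : x ^ (-δ) ≤ a ^ (-δ) := Real.rpow_le_rpow_of_nonpos ha hx (by linarith)
  have h6 : 0 < x ^ (-δ) := by positivity
  have h7 : y / x - 1 = (y - x) / x := by field_simp
  calc x ^ (-δ) - y ^ (-δ) = x ^ (-δ) * (1 - (y / x) ^ (-δ)) := by rw [h4]; ring
    _ ≤ x ^ (-δ) * (δ * (y / x - 1)) := by gcongr; linarith
    _ ≤ a ^ (-δ) * (δ * ((y - x) / a)) := by
        rw [h7]
        have : 0 ≤ y - x := sub_nonneg.2 hxy
        gcongr
    _ = _ := by ring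

section

variable {Ω : Type*} [MeasurableSpace Ω] {P : Measure Ω} [IsProbabilityMeasure P]
  {μ : Measure ℝ≥0∞} {C δ : ℝ} {X : ℕ → Ω → ℝ≥0∞} {L : ℕ}

/-- The bounds for the intervals of a grid of mesh `w` add up. -/
lemma HasPoissonCounts.measure_grid_le (h : HasPoissonCounts X μ P) (hμ : HasPowerTail μ C δ)
    (hC : 0 ≤ C) (hδ : 0 < δ) (hδ1 : δ < 1) (hL : 1 ≤ L) {a w t : ℝ} (ha : 0 < a) (hw : 0 < w)
    (k : ℕ) :
    P {ω | (primarySup L fun n => X n ω) ∈ Ioc (ENNReal.ofReal a) (ENNReal.ofReal (a + k * w)) ∧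
      ENNReal.ofReal t ≤ residualPower L fun n => X n ω} ≤
    ∫⁻ ω in {ω | (primarySup L fun n => X n ω) ∈
        Ioc (ENNReal.ofReal a) (ENNReal.ofReal (a + k * w))},
      ENNReal.ofReal (levelBound C δ (t - 2 * w) (primarySup L fun n => X n ω).toReal) ∂P +
    ENNReal.ofReal (k * (C * (δ * a ^ (-δ) / a * w)) ^ 2) := by
  have hG := measurable_primarySup h.measurable L
  induction k with
  | zero => simp
  | succ k ih =>
    set x := a + k * w
    set x' := a + (k + 1 : ℕ) * w
    have hax : a ≤ x := le_add_of_nonneg_right (by positivity)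
    have hxx : x' - x = w := by simp only [x, x']; push_cast; ring
    have hle : x ≤ x' := by linarith
    have hu : Ioc (ENNReal.ofReal a) (ENNReal.ofReal x') =
        Ioc (ENNReal.ofReal a) (ENNReal.ofReal x) ∪
          Ioc (ENNReal.ofReal x) (ENNReal.ofReal x') :=
      (Ioc_union_Ioc_eq_Ioc (ENNReal.ofReal_le_ofReal hax) (ENNReal.ofReal_le_ofReal hle)).symm
    -- Any slack above the bin width `w` would do; `2 * w` is strictly larger and still vanishes
    -- with the mesh.
    have hbin := h.measure_bin_le hμ hC hδ hδ1 hL (e := 2 * w) (t := t) (ha.trans_le hax) hle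
      (by linarith)
    have hlip : C * x ^ (-δ) - C * x' ^ (-δ) ≤ C * (δ * a ^ (-δ) / a * w) := by
      rw [← mul_sub, ← hxx]
      exact mul_le_mul_of_nonneg_left (rpow_neg_sub_rpow_neg_le hδ hδ1 ha hax hle) hC
    have hlip0 : 0 ≤ C * x ^ (-δ) - C * x' ^ (-δ) :=
      sub_nonneg.2 (mul_le_mul_of_nonneg_left
        (Real.rpow_le_rpow_of_nonpos (ha.trans_le hax) hle (by linarith)) hC)
    have hsets : {ω | (primarySup L fun n => X n ω) ∈ Ioc (ENNReal.ofReal a) (ENNReal.ofReal x')} =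
        {ω | (primarySup L fun n => X n ω) ∈ Ioc (ENNReal.ofReal a) (ENNReal.ofReal x)} ∪
        {ω | (primarySup L fun n => X n ω) ∈ Ioc (ENNReal.ofReal x) (ENNReal.ofReal x')} := by
      rw [hu]
      rfl
    have hms : MeasurableSet
        {ω | (primarySup L fun n => X n ω) ∈ Ioc (ENNReal.ofReal x) (ENNReal.ofReal x')} :=
      hG measurableSet_Ioc
    rw [hsets, lintegral_union hms]
    · have hsub : {ω | (primarySup L fun n => X n ω) ∈
          Ioc (ENNReal.ofReal a) (ENNReal.ofReal x') ∧
          ENNReal.ofReal t ≤ residualPower L fun n => X n ω} ⊆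
          {ω | (primarySup L fun n => X n ω) ∈ Ioc (ENNReal.ofReal a) (ENNReal.ofReal x) ∧
            ENNReal.ofReal t ≤ residualPower L fun n => X n ω} ∪
          {ω | (primarySup L fun n => X n ω) ∈ Ioc (ENNReal.ofReal x) (ENNReal.ofReal x') ∧
            ENNReal.ofReal t ≤ residualPower L fun n => X n ω} := by
        rintro ω ⟨hω, hR⟩
        rw [hu] at hω
        exact hω.imp (fun h => ⟨h, hR⟩) fun h => ⟨h, hR⟩
      refine (measure_mono hsub).trans ((measure_union_le _ _).trans
        ((add_le_add ih hbin).trans ?_))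
      rw [add_add_add_comm, ← ENNReal.ofReal_add (by positivity) (by positivity)]
      gcongr
      push_cast
      rw [add_mul, one_mul]
      gcongr
    · refine Set.disjoint_left.2 fun ω h1 h2 => ?_
      have h1' : _ ∈ Ioc _ _ := h1
      have h2' : _ ∈ Ioc _ _ := h2
      exact not_lt.2 h1'.2 h2'.1

/-- With `n + 1` bins of width `w = (t - a) / (n + 1)` the total error `(n + 1) * (K * w) ^ 2` is `K
^ 2 * (t - a) * w`, which tends to `0`. -/
lemma HasPoissonCounts.measure_primarySup_mem_Ioc_le (h : HasPoissonCounts X μ P)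
    (hμ : HasPowerTail μ C δ) (hC : 0 ≤ C) (hδ : 0 < δ) (hδ1 : δ < 1) (hL : 1 ≤ L) {a t : ℝ}
    (ha : 0 < a) (hat : a < t) :
    P {ω | (primarySup L fun n => X n ω) ∈ Ioc (ENNReal.ofReal a) (ENNReal.ofReal t) ∧
      ENNReal.ofReal t ≤ residualPower L fun n => X n ω} ≤
    ∫⁻ ω in {ω | (primarySup L fun n => X n ω) ∈ Ioc (ENNReal.ofReal a) (ENNReal.ofReal t)},
      ENNReal.ofReal (levelBound C δ t (primarySup L fun n => X n ω).toReal) ∂P := by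
  have hG := measurable_primarySup h.measurable L
  set w : ℕ → ℝ := fun n => (t - a) / (n + 1 : ℕ)
  have hw0 : ∀ n, 0 < w n := fun n => div_pos (sub_pos.2 hat) (by positivity)
  have hwlim : Tendsto w atTop (𝓝 0) :=
    (tendsto_const_div_atTop_nhds_zero_nat (t - a)).comp (tendsto_add_atTop_nat 1)
  have hend : ∀ n, a + (n + 1 : ℕ) * w n = t := by
    intro n
    simp only [w]
    rw [mul_div_cancel₀ _ (by positivity)]
    ring
  set K := C * (δ * a ^ (-δ) / a)
  have hgrid : ∀ n, _ := fun n => h.measure_grid_le hμ hC hδ hδ1 hL (t := t) ha (hw0 n) (n + 1)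
  simp only [hend] at hgrid
  have herr : ∀ n, ((n + 1 : ℕ) : ℝ) * (C * (δ * a ^ (-δ) / a * w n)) ^ 2 =
      K ^ 2 * (t - a) * w n := by
    intro n
    have h1 : ((n + 1 : ℕ) : ℝ) * w n = t - a := by linarith [hend n]
    rw [← h1]
    simp only [K]
    ring
  simp only [herr] at hgrid
  refine ge_of_tendsto' (x := atTop) ?_ hgrid
  rw [← add_zero (∫⁻ ω in _, _ ∂P)]
  refine Tendsto.add ?_ ?_
  · have hm (s : ℝ) : Measurable fun ω => ENNReal.ofReal
        (levelBound C δ s (primarySup L fun n => X n ω).toReal) :=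
      ((measurable_levelBound C δ).comp
        (measurable_const.prodMk hG.ennreal_toReal)).ennreal_ofReal
    refine tendsto_lintegral_of_dominated_convergence (fun _ => 1) (fun n => hm _)
      (fun n => ae_of_all _ fun ω => ?_) ?_ (ae_of_all _ fun ω => ?_)
    · exact ENNReal.ofReal_le_one.2 (levelBound_le_one _ _ _ _)
    · simp
    · refine ENNReal.tendsto_ofReal (tendsto_levelBound C δ _ t ?_ fun n => ?_)
      · simpa using hwlim.const_mul 2
      · have := hw0 n
        positivity
  · rw [← ENNReal.ofReal_zero]
    refine ENNReal.tendsto_ofReal ?_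
    simpa using hwlim.const_mul (K ^ 2 * (t - a))

/-- The conditional Chebyshev bound, integrated over the law of the primary power. -/
theorem HasPoissonCounts.measure_primarySup_le_and_le (h : HasPoissonCounts X μ P)
    (hμ : HasPowerTail μ C δ) (hC : 0 < C) (hδ : 0 < δ) (hδ1 : δ < 1) (hL : 1 ≤ L) {t : ℝ}
    (ht : 0 < t) :
    P {ω | (primarySup L fun n => X n ω) ≤ ENNReal.ofReal t ∧
      ENNReal.ofReal t ≤ residualPower L fun n => X n ω} ≤
    ∫⁻ ω in {ω | (primarySup L fun n => X n ω) ≤ ENNReal.ofReal t},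
      ENNReal.ofReal (levelBound C δ t (primarySup L fun n => X n ω).toReal) ∂P := by
  -- The denominator `k + 2` keeps the lower cutoff strictly below `t`. The cutoff can tend to `0`
  -- because the primary power is almost surely positive.
  set S : ℕ → Set Ω := fun k => {ω | (primarySup L fun n => X n ω) ∈
    Ioc (ENNReal.ofReal (t / (k + 2 : ℕ))) (ENNReal.ofReal t) ∧
      ENNReal.ofReal t ≤ residualPower L fun n => X n ω}
  have hmono : Monotone S := by
    intro i j hij ω hω
    refine ⟨⟨lt_of_le_of_lt (ENNReal.ofReal_le_ofReal ?_) hω.1.1, hω.1.2⟩, hω.2⟩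
    gcongr
  have hlim : Tendsto (fun k : ℕ => ENNReal.ofReal (t / (k + 2 : ℕ))) atTop (𝓝 0) := by
    rw [← ENNReal.ofReal_zero]
    exact ENNReal.tendsto_ofReal
      ((tendsto_const_div_atTop_nhds_zero_nat t).comp (tendsto_add_atTop_nat 2))
  have hae : P {ω | (primarySup L fun n => X n ω) ≤ ENNReal.ofReal t ∧
      ENNReal.ofReal t ≤ residualPower L fun n => X n ω} ≤ P (⋃ k, S k) := by
    refine measure_mono_ae ?_
    filter_upwards [h.ae_primarySup_pos hμ hC hδ hL] with ω hω hmem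
    obtain ⟨k, hk⟩ := (hlim.eventually_lt_const hω).exists
    exact mem_iUnion.2 ⟨k, ⟨hk, hmem.1⟩, hmem.2⟩
  refine hae.trans ?_
  rw [hmono.measure_iUnion]
  refine iSup_le fun k => ?_
  refine (h.measure_primarySup_mem_Ioc_le hμ hC.le hδ hδ1 hL (by positivity) ?_).trans ?_
  · refine div_lt_self ht ?_
    push_cast
    have : (0 : ℝ) ≤ k := k.cast_nonneg
    linarith
  · refine lintegral_mono_set ?_
    intro ω hω
    exact hω.2

end

end MANET

namespace MANET

open Filter Topology Set

/-! ### The constants -/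

section Constants

variable {α : ℝ}

lemma delta_pos (hα : 2 < α) : 0 < delta α := div_pos two_pos (by linarith)

lemma delta_lt_one (hα : 2 < α) : delta α < 1 := (div_lt_one (by linarith)).2 hα

lemma Gamma_one_add_delta_pos (hα : 2 < α) : 0 < Real.Gamma (1 + delta α) :=
  Real.Gamma_pos_of_pos (by linarith [delta_pos hα])

/-- The constant in the tail of the interference powers. -/
noncomputable def tailConst (α lam : ℝ) : ℝ := lam * Real.pi * Real.Gamma (1 + delta α)

lemma tailConst_pos (hα : 2 < α) {lam : ℝ} (hlam : 0 < lam) : 0 < tailConst α lam := by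
  have := Gamma_one_add_delta_pos hα
  unfold tailConst
  positivity

lemma tailConst_mean (hα : 2 < α) (lam : ℝ) :
    tailConst α lam * delta α / (1 - delta α) = c₄ α * lam := by
  have h1 : α ≠ 0 := by linarith
  have h2 : α - 2 ≠ 0 := by linarith
  have h3 : 1 - delta α = (α - 2) / α := by unfold delta; field_simp
  rw [h3, tailConst, c₄]
  generalize Real.Gamma (1 + delta α) = Γ
  unfold delta
  field_simp

lemma tailConst_variance (hα : 2 < α) (lam : ℝ) :
    tailConst α lam * delta α / (2 - delta α) = c₃ α * lam := by
  have h1 : α ≠ 0 := by linarith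
  have h2 : α - 1 ≠ 0 := by linarith
  have h3 : 2 - delta α = 2 * (α - 1) / α := by unfold delta; field_simp
  rw [h3, tailConst, c₃]
  generalize Real.Gamma (1 + delta α) = Γ
  unfold delta
  field_simp

/-- The power level below which the residual interference has to stay. -/
noncomputable def level (α θ d w : ℝ) : ℝ := d ^ (-α) * θ⁻¹ * w

lemma levelMargin_eq (hα : 2 < α) (θ d lam w g : ℝ) :
    levelMargin (tailConst α lam) (delta α) (level α θ d w) g = margin α θ d lam w g := by
  rw [levelMargin, tailConst_mean hα, margin, level]

lemma levelBound_eq (hα : 2 < α) (θ d lam w g : ℝ) :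
    levelBound (tailConst α lam) (delta α) (level α θ d w) g = chebBound α θ d lam w g := by
  rw [levelBound, levelMargin_eq hα, tailConst_variance hα, chebBound, chebRatio]

lemma level_pos {θ d w : ℝ} (hθ : 0 < θ) (hd : 0 < d) (hw : 0 < w) : 0 < level α θ d w := by
  unfold level
  positivity

lemma c₂_mul_eq (hα : 2 < α) {θ d lam w : ℝ} (hθ : 0 < θ) (hd : 0 < d) (hw : 0 < w) :
    c₂ α θ d * lam * w ^ (-delta α) = tailConst α lam * level α θ d w ^ (-delta α) := by
  have h1 : (d ^ (-α)) ^ (-delta α) = d ^ 2 := by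
    rw [← Real.rpow_mul hd.le, ← Real.rpow_natCast, delta]
    congr 1
    have : α ≠ 0 := by linarith
    push_cast
    field_simp
  have h2 : (θ⁻¹) ^ (-delta α) = θ ^ delta α := by
    rw [Real.rpow_neg (by positivity), Real.inv_rpow hθ.le, inv_inv]
  rw [level, Real.mul_rpow (by positivity) hw.le, Real.mul_rpow (by positivity) (by positivity),
    h1, h2, c₂, tailConst]
  ring

/-- In a sparse network the Chebyshev ratio is at least `1` where the margin is negative. -/
lemma chebBound_le_of_sparse (hα : 2 < α) {θ d β lam w g : ℝ} (hθ : 0 < θ) (hβ : 0 ≤ β)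
    (hlam : 0 < lam)
    (hsparse : c₄ α ^ 2 * lam ≤ c₃ α * (β / (2 * θ)) ^ delta α) (hg : 0 < g)
    (hgl : g < level α θ d w) (hβl : β / θ ≤ level α θ d w) (hne : margin α θ d lam w g ≠ 0) :
    chebBound α θ d lam w g ≤ min (chebRatio α θ d lam w g) 1 := by
  rw [chebBound]
  split_ifs with h
  · exact le_rfl
  refine le_min ?_ le_rfl
  have hδ := delta_pos hα
  have hδ1 := delta_lt_one hα
  have hΓ := Gamma_one_add_delta_pos hα
  have hα2 : 0 < α - 2 := by linarith
  have hα1 : 0 < α - 1 := by linarith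
  have hc₄ : 0 < c₄ α := by unfold c₄; positivity
  have hc₃ : 0 < c₃ α := by unfold c₃; positivity
  have hlt : margin α θ d lam w g < 0 := lt_of_le_of_ne (not_lt.1 h) hne
  set m := c₄ α * lam * g ^ (1 - delta α) with hm
  have hmar : margin α θ d lam w g = level α θ d w - g - m := rfl
  set b := β / (2 * θ) with hb
  have hb2 : 2 * b = β / θ := by
    rw [hb]
    ring_nf
  -- If `g < b`, then since the level is at least `2 * b`, a negative margin forces `m > b`, hence
  -- `b ^ δ < c₄ * λ`. Sparsity then gives `c₄ < c₃`, whereas `c₃ ≤ c₄` always holds.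
  have hbg : b ≤ g := by
    by_contra! hgb
    have hb0 : 0 < b := hg.trans hgb
    have h1 : b < c₄ α * lam * b ^ (1 - delta α) := by
      have h2 : m ≤ c₄ α * lam * b ^ (1 - delta α) := by
        rw [hm]
        have : 0 ≤ 1 - delta α := by linarith
        gcongr
      linarith
    have h3 : b = b ^ delta α * b ^ (1 - delta α) := by
      rw [← Real.rpow_add hb0, add_sub_cancel, Real.rpow_one]
    have h4 : 0 < b ^ (1 - delta α) := by positivity
    have h5 : b ^ delta α < c₄ α * lam := by
      rw [h3] at h1
      have h6 : (b ^ delta α * b ^ (1 - delta α)) ^ (1 - delta α) = b ^ (1 - delta α) := by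
        rw [← h3]
      rw [h6] at h1
      exact lt_of_mul_lt_mul_right h1 h4.le
    have h7 : c₄ α ^ 2 * lam < c₃ α * (c₄ α * lam) :=
      hsparse.trans_lt (mul_lt_mul_of_pos_left h5 hc₃)
    have h8 : c₄ α < c₃ α := by
      have h9 : 0 < c₄ α * lam := by positivity
      nlinarith
    have h10 : c₃ α ≤ c₄ α := by
      unfold c₃ c₄
      rw [div_le_div_iff₀ hα1 hα2]
      have : 0 < Real.pi * Real.Gamma (1 + delta α) := by positivity
      nlinarith
    linarith
  have hkey : c₄ α ^ 2 * lam ≤ c₃ α * g ^ delta α := hsparse.trans (by gcongr)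
  have hm0 : 0 < m := by positivity
  -- As `g` is below the level, the negative margin is greater than `-m`.
  have hsq : margin α θ d lam w g ^ 2 ≤ m ^ 2 := sq_le_sq' (by linarith) (by linarith)
  rw [chebRatio, one_le_div (by positivity)]
  refine hsq.trans ?_
  have h11 : g ^ (2 - delta α) = g ^ delta α * (g ^ (1 - delta α)) ^ 2 := by
    rw [← Real.rpow_natCast, ← Real.rpow_mul hg.le, ← Real.rpow_add hg]
    congr 1
    push_cast
    ring
  rw [h11, hm]
  have h12 : 0 ≤ lam * (g ^ (1 - delta α)) ^ 2 := by positivity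
  calc (c₄ α * lam * g ^ (1 - delta α)) ^ 2 =
      c₄ α ^ 2 * lam * (lam * (g ^ (1 - delta α)) ^ 2) := by ring
    _ ≤ c₃ α * g ^ delta α * (lam * (g ^ (1 - delta α)) ^ 2) := by gcongr
    _ = _ := by ring

end Constants

/-! ### Averaging over the data link -/

section Indep

variable {Ω A B : Type*} [MeasurableSpace Ω] [MeasurableSpace A] [MeasurableSpace B]
  {P : Measure Ω} [IsProbabilityMeasure P] {W : Ω → A} {Z : Ω → B}

/-- Fubini for the product law of an independent pair: estimates for a deterministic level carry
over to the random one. -/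
lemma lintegral_comp_of_indepFun (hW : Measurable W) (hZ : Measurable Z) (h : IndepFun W Z P)
    {f : A × B → ℝ≥0∞} (hf : Measurable f) :
    ∫⁻ ω, f (W ω, Z ω) ∂P = ∫⁻ ω', ∫⁻ ω, f (W ω', Z ω) ∂P ∂P := by
  have := Measure.isProbabilityMeasure_map (μ := P) hZ.aemeasurable
  have hfs : ∀ a, Measurable fun b => f (a, b) := fun a => hf.comp measurable_prodMk_left
  have h1 : Measurable fun a => ∫⁻ b, f (a, b) ∂(P.map Z) := hf.lintegral_prod_right'
  rw [← lintegral_map hf (hW.prodMk hZ),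
    (indepFun_iff_map_prod_eq_prod_map_map hW.aemeasurable hZ.aemeasurable).1 h,
    lintegral_prod _ hf.aemeasurable, lintegral_map h1 hW]
  exact lintegral_congr fun ω' => lintegral_map (hfs _) hZ

/-- The sections of the graph of `φ` are single points, which are null for an atomless law. -/
lemma ae_ne_of_indepFun [MeasurableEq A] (hW : Measurable W) (hZ : Measurable Z)
    (h : IndepFun W Z P) (hW0 : ∀ a, P.map W {a} = 0) {φ : B → A} (hφ : Measurable φ) :
    ∀ᵐ ω ∂P, W ω ≠ φ (Z ω) := by
  have := Measure.isProbabilityMeasure_map (μ := P) hZ.aemeasurable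
  have := Measure.isProbabilityMeasure_map (μ := P) hW.aemeasurable
  have hS : MeasurableSet {p : A × B | p.1 = φ p.2} :=
    measurableSet_eq_fun measurable_fst (hφ.comp measurable_snd)
  have h1 : P.map (fun ω => (W ω, Z ω)) {p : A × B | p.1 = φ p.2} = 0 := by
    rw [(indepFun_iff_map_prod_eq_prod_map_map hW.aemeasurable hZ.aemeasurable).1 h,
      Measure.prod_apply_symm hS]
    simp only [preimage_ofPred_eq, ofPred_eq_eq_singleton, hW0,
      lintegral_zero]
  rw [Measure.map_apply (hW.prodMk hZ) hS] at h1
  exact measure_eq_zero_iff_ae_notMem.1 h1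

/-- The factor `1 - PL` in the upper bounds is the probability of the conditioning event, so it
cancels the normalization. If that probability is `0`, both sides vanish. -/
lemma measureReal_mul_integral_cond {D : Set Ω} (f : Ω → ℝ) :
    P.real D * ∫ ω, f ω ∂(P[|D]) = ∫ ω in D, f ω ∂P := by
  rw [ProbabilityTheory.cond, integral_smul_measure, smul_eq_mul, ENNReal.toReal_inv, ← mul_assoc]
  by_cases hD : P D = 0
  · rw [Measure.restrict_eq_zero.2 hD]
    simp
  · rw [measureReal_def, mul_inv_cancel₀ (ENNReal.toReal_ne_zero.2 ⟨hD, measure_ne_top P D⟩),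
      one_mul]

end Indep

lemma dataGainLaw_singleton (α d β w : ℝ) : dataGainLaw α d β {w} = 0 :=
  withDensity_absolutelyContinuous _ _ (by simp)

lemma ae_le_dataGainLaw (α d β : ℝ) : ∀ᵐ w ∂(dataGainLaw α d β), β * d ^ α ≤ w := by
  rw [dataGainLaw, ae_withDensity_iff]
  · refine ae_of_all _ fun w hw => ?_
    by_contra h
    exact hw (if_neg h)
  · exact Measurable.ite measurableSet_Ici (by fun_prop) measurable_const

end MANET

/-! ### The outage bounds -/

namespace MANET

open Filter Topology Set

/-- A random variable independent of two sequences is independent of a sequence computed from them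
term by term. -/
lemma indepFun_map₂ {Ω E F K : Type*} [MeasurableSpace Ω] [MeasurableSpace E] [MeasurableSpace F] [MeasurableSpace K]
    {P : Measure Ω} {W : Ω → ℝ} {T : ℕ → Ω → E} {ρ : ℕ → Ω → F} {g : E → F → K} (hg : Measurable fun p : E × F => g p.1 p.2)
    (h : IndepFun W (fun ω => ((fun n => T n ω), (fun n => ρ n ω))) P) :
    IndepFun W (fun ω n => g (T n ω) (ρ n ω)) P := by
  have hg' : Measurable fun (p : (ℕ → E) × (ℕ → F)) (n : ℕ) => g (p.1 n) (p.2 n) :=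
    measurable_pi_lambda _ fun n => hg.comp
      (f := fun p : (ℕ → E) × (ℕ → F) => (p.1 n, p.2 n)) (by fun_prop)
  exact h.comp (φ := id) measurable_id hg'

section Outage

variable {Ω : Type*} [MeasurableSpace Ω] {P : Measure Ω} [IsProbabilityMeasure P] {L : ℕ}
  {α θ d lam : ℝ} {X : ℕ → Ω → ℝ≥0∞} {W : Ω → ℝ}

/-- The extremes agree as well: without residual power the quotient is `∞` and there is no outage;
with infinite residual power it is `0`. -/
lemma sir_le_iff {J : ℕ → ℝ≥0∞} {w : ℝ} (hθ : 0 < θ) (hd : 0 < d) (hw : 0 < w) :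
    sir L α d w J ≤ ENNReal.ofReal θ ↔ ENNReal.ofReal (level α θ d w) ≤ residualPower L J := by
  have h1 : level α θ d w = d ^ (-α) * w / θ := by
    unfold level
    field_simp
  have hpos : 0 < d ^ (-α) * w := by positivity
  rw [sir, ENNReal.div_le_iff_le_mul (Or.inr ENNReal.ofReal_ne_top)
    (Or.inr (ENNReal.ofReal_pos.2 hθ).ne'), h1, ENNReal.ofReal_div_of_pos hθ,
    ENNReal.div_le_iff_le_mul (Or.inl (ENNReal.ofReal_pos.2 hθ).ne') (Or.inl ENNReal.ofReal_ne_top),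
    mul_comm (residualPower L J)]

lemma lt_div_toReal_iff {y : ℝ≥0∞} {w : ℝ} (hθ : 0 < θ) (hd : 0 < d) (hy0 : 0 < y)
    (hyt : y ≠ ∞) : d ^ α * θ < w / y.toReal ↔ y.toReal < level α θ d w := by
  have hy : 0 < y.toReal := ENNReal.toReal_pos hy0.ne' hyt
  have hda : 0 < d ^ α := by positivity
  rw [lt_div_iff₀ hy, level, Real.rpow_neg hd.le, ← mul_inv, inv_mul_eq_div,
    lt_div_iff₀ (by positivity), mul_comm]

lemma measurable_level (α θ d : ℝ) : Measurable (level α θ d) := by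
  unfold level
  fun_prop

/-- `1 - P^L` is the probability that the primary interferer does not cause an outage. -/
lemma HasPoissonCounts.measure_primarySup_le_level
    (hα : 2 < α) (hθ : 0 < θ) (hd : 0 < d) (hlam : 0 < lam) (hL : 1 ≤ L) {μ : Measure ℝ≥0∞}
    (hX : HasPoissonCounts X μ P) (hμ : HasPowerTail μ (tailConst α lam) (delta α))
    (hWm : Measurable W) (hW0 : ∀ᵐ ω ∂P, 0 < W ω) (hWX : IndepFun W (fun ω n => X n ω) P) :
    P.real {ω | (primarySup L fun n => X n ω) ≤ ENNReal.ofReal (level α θ d (W ω))} =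
      1 - outageLower P L α θ d lam W := by
  set F : ℝ → ℝ := fun w => 1 / Real.Gamma L * lowerGamma L (c₂ α θ d * lam * w ^ (-delta α))
  have hFm : Measurable F := by
    have : F = fun w => 1 - ∑ k ∈ Finset.range L, Real.exp (-(c₂ α θ d * lam * w ^ (-delta α))) *
        (c₂ α θ d * lam * w ^ (-delta α)) ^ k / k.factorial :=
      funext fun w => lowerGamma_natCast L hL _
    rw [this]
    fun_prop
  have hC := tailConst_pos hα hlam
  have hFprob : ∀ w, 0 < w → P {ω | (primarySup L fun n => X n ω) ≤
      ENNReal.ofReal (level α θ d w)} = ENNReal.ofReal (1 - F w) := by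
    intro w hw
    rw [hX.measure_primarySup_le hμ hC.le hL (level_pos hθ hd hw), ← c₂_mul_eq hα hθ hd hw]
  have hF1 : ∀ w, 0 < w → F w ≤ 1 := by
    intro w hw
    have h0 := level_pos (α := α) hθ hd hw
    simp only [F]
    rw [lowerGamma_natCast L hL, c₂_mul_eq hα hθ hd hw]
    have : 0 ≤ ∑ k ∈ Finset.range L, Real.exp (-(tailConst α lam * level α θ d w ^ (-delta α))) *
        (tailConst α lam * level α θ d w ^ (-delta α)) ^ k / k.factorial :=
      Finset.sum_nonneg fun k _ => by positivity
    linarith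
  have hF0 : ∀ w, 0 < w → 0 ≤ F w := by
    intro w hw
    have h1 : ENNReal.ofReal (1 - F w) ≤ 1 := by
      rw [← hFprob w hw]
      exact prob_le_one
    have := ENNReal.ofReal_le_one.1 h1
    linarith
  have hFint : Integrable (fun ω => F (W ω)) P := by
    refine Integrable.of_bound (hFm.comp hWm).aestronglyMeasurable 1 ?_
    filter_upwards [hW0] with ω hω
    rw [Real.norm_of_nonneg (hF0 _ hω)]
    exact hF1 _ hω
  have hXm : Measurable fun ω n => X n ω := measurable_pi_lambda _ hX.measurable
  have hS : MeasurableSet {p : ℝ × (ℕ → ℝ≥0∞) | primarySup L p.2 ≤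
      ENNReal.ofReal (level α θ d p.1)} :=
    measurableSet_le ((measurable_iSup_residual L).comp measurable_snd)
      ((measurable_level α θ d).comp measurable_fst).ennreal_ofReal
  have hP : P {ω | (primarySup L fun n => X n ω) ≤ ENNReal.ofReal (level α θ d (W ω))} =
      ∫⁻ ω, ENNReal.ofReal (1 - F (W ω)) ∂P := by
    have h1 := lintegral_comp_of_indepFun hWm hXm hWX
      (f := {p : ℝ × (ℕ → ℝ≥0∞) | primarySup L p.2 ≤
        ENNReal.ofReal (level α θ d p.1)}.indicator 1) (measurable_one.indicator hS)
    have h2 : ∀ w, MeasurableSet {ω | (primarySup L fun n => X n ω) ≤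
        ENNReal.ofReal (level α θ d w)} := fun w =>
      measurableSet_le (measurable_primarySup hX.measurable L) measurable_const
    have h3 : MeasurableSet {ω | (primarySup L fun n => X n ω) ≤
        ENNReal.ofReal (level α θ d (W ω))} := (hWm.prodMk hXm) hS
    rw [← lintegral_indicator_one h3]
    refine h1.trans (lintegral_congr_ae ?_)
    filter_upwards [hW0] with ω' hω'
    rw [← hFprob _ hω', ← lintegral_indicator_one (h2 _)]
    rfl
  have h1F : Integrable (fun ω => 1 - F (W ω)) P := (integrable_const 1).sub hFint
  rw [measureReal_def, hP, ← ofReal_integral_eq_lintegral_ofReal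
    h1F (hW0.mono fun ω hω => sub_nonneg.2 (hF1 _ hω)),
    ENNReal.toReal_ofReal (integral_nonneg_of_ae (hW0.mono fun ω hω => sub_nonneg.2 (hF1 _ hω))),
    integral_sub (integrable_const 1) hFint, outageLower, ← integral_const_mul]
  simp [F]

lemma chebBound_le_one (α θ d lam w g : ℝ) : chebBound α θ d lam w g ≤ 1 := by
  rw [chebBound]
  split_ifs
  exacts [min_le_right _ _, le_rfl]

lemma measurable_margin (α θ d lam : ℝ) :
    Measurable fun p : ℝ × ℝ => margin α θ d lam p.1 p.2 := by
  unfold margin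
  fun_prop

lemma measurable_chebRatio (α θ d lam : ℝ) :
    Measurable fun p : ℝ × ℝ => chebRatio α θ d lam p.1 p.2 := by
  have := measurable_margin α θ d lam
  unfold chebRatio
  fun_prop

lemma measurable_chebBound (α θ d lam : ℝ) :
    Measurable fun p : ℝ × ℝ => chebBound α θ d lam p.1 p.2 := by
  have := measurable_margin α θ d lam
  have := measurable_chebRatio α θ d lam
  unfold chebBound
  refine Measurable.ite (measurableSet_lt measurable_const ‹_›) ?_ measurable_const
  fun_prop

lemma chebRatio_nonneg (hα : 2 < α) (hlam : 0 < lam) {g : ℝ} (hg : 0 ≤ g) (w : ℝ) :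
    0 ≤ chebRatio α θ d lam w g := by
  have := Gamma_one_add_delta_pos hα
  have : 0 < α - 1 := by linarith
  unfold chebRatio c₃
  positivity

lemma chebBound_nonneg (hα : 2 < α) (hlam : 0 < lam) {g : ℝ} (hg : 0 ≤ g) (w : ℝ) :
    0 ≤ chebBound α θ d lam w g := by
  rw [chebBound]
  split_ifs
  exacts [le_min (chebRatio_nonneg hα hlam hg w) zero_le_one, zero_le_one]

/-- The probability that only the secondary interferers cause an outage. -/
lemma HasPoissonCounts.measure_secondary_le
    (hα : 2 < α) (hθ : 0 < θ) (hd : 0 < d) (hlam : 0 < lam) (hL : 1 ≤ L) {μ : Measure ℝ≥0∞}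
    (hX : HasPoissonCounts X μ P) (hμ : HasPowerTail μ (tailConst α lam) (delta α))
    (hWm : Measurable W) (hW0 : ∀ᵐ ω ∂P, 0 < W ω) (hWX : IndepFun W (fun ω n => X n ω) P) :
    P.real {ω | (primarySup L fun n => X n ω) ≤ ENNReal.ofReal (level α θ d (W ω)) ∧
      ENNReal.ofReal (level α θ d (W ω)) ≤ residualPower L fun n => X n ω} ≤
    ∫ ω in {ω | (primarySup L fun n => X n ω) ≤ ENNReal.ofReal (level α θ d (W ω))},
      chebBound α θ d lam (W ω) (primarySup L fun n => X n ω).toReal ∂P := by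
  have hC := tailConst_pos hα hlam
  have hδ := delta_pos hα
  have hδ1 := delta_lt_one hα
  have hXm : Measurable fun ω n => X n ω := measurable_pi_lambda _ hX.measurable
  have hGm := measurable_primarySup hX.measurable L
  have hps : Measurable fun p : ℝ × (ℕ → ℝ≥0∞) => primarySup L p.2 :=
    (measurable_iSup_residual L).comp measurable_snd
  have hlev : Measurable fun p : ℝ × (ℕ → ℝ≥0∞) => ENNReal.ofReal (level α θ d p.1) :=
    ((measurable_level α θ d).comp measurable_fst).ennreal_ofReal
  set S : Set (ℝ × (ℕ → ℝ≥0∞)) := {p | primarySup L p.2 ≤ ENNReal.ofReal (level α θ d p.1)}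
  set S' : Set (ℝ × (ℕ → ℝ≥0∞)) := {p | ENNReal.ofReal (level α θ d p.1) ≤ residualPower L p.2}
  have hS : MeasurableSet S := measurableSet_le hps hlev
  have hS' : MeasurableSet S' :=
    measurableSet_le hlev ((measurable_residualPower L).comp measurable_snd)
  set f : ℝ × (ℕ → ℝ≥0∞) → ℝ≥0∞ := fun p =>
    ENNReal.ofReal (chebBound α θ d lam p.1 (primarySup L p.2).toReal)
  have hf : Measurable f := ((measurable_chebBound α θ d lam).comp
    (measurable_fst.prodMk hps.ennreal_toReal)).ennreal_ofReal
  have hWXm : Measurable fun ω => (W ω, fun n => X n ω) := hWm.prodMk hXm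
  have h1 := lintegral_comp_of_indepFun hWm hXm hWX (f := (S ∩ S').indicator 1)
    (measurable_one.indicator (hS.inter hS'))
  have h2 := lintegral_comp_of_indepFun hWm hXm hWX (f := S.indicator f) (hf.indicator hS)
  have hle : ∫⁻ ω, (S ∩ S').indicator 1 (W ω, fun n => X n ω) ∂P ≤
      ∫⁻ ω, S.indicator f (W ω, fun n => X n ω) ∂P := by
    rw [h1, h2]
    refine lintegral_mono_ae ?_
    filter_upwards [hW0] with ω' hω'
    have hsec := hX.measure_primarySup_le_and_le hμ hC hδ hδ1 hL
      (level_pos (α := α) hθ hd hω')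
    have hm1 : MeasurableSet {ω | (primarySup L fun n => X n ω) ≤
        ENNReal.ofReal (level α θ d (W ω'))} := measurableSet_le hGm measurable_const
    have hm2 : MeasurableSet {ω | ENNReal.ofReal (level α θ d (W ω')) ≤
        residualPower L fun n => X n ω} :=
      measurableSet_le measurable_const ((measurable_residualPower L).comp hXm)
    rw [← lintegral_indicator hm1] at hsec
    simp only [levelBound_eq hα] at hsec
    exact (lintegral_indicator_one (hm1.inter hm2)).trans_le hsec
  have h3 : P {ω | (primarySup L fun n => X n ω) ≤ ENNReal.ofReal (level α θ d (W ω)) ∧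
      ENNReal.ofReal (level α θ d (W ω)) ≤ residualPower L fun n => X n ω} =
      ∫⁻ ω, (S ∩ S').indicator 1 (W ω, fun n => X n ω) ∂P :=
    (lintegral_indicator_one (hWXm (hS.inter hS'))).symm
  have h4 : ∫⁻ ω, S.indicator f (W ω, fun n => X n ω) ∂P =
      ∫⁻ ω in {ω | (primarySup L fun n => X n ω) ≤ ENNReal.ofReal (level α θ d (W ω))},
        f (W ω, fun n => X n ω) ∂P :=
    (lintegral_indicator (hWXm hS) fun ω => f (W ω, fun n => X n ω))
  rw [← h3, h4] at hle
  refine ENNReal.toReal_le_of_le_ofReal ?_ ?_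
  · exact integral_nonneg fun ω => chebBound_nonneg hα hlam ENNReal.toReal_nonneg _
  · rwa [ofReal_integral_eq_lintegral_ofReal]
    · refine Integrable.of_bound ((measurable_chebBound α θ d lam).comp
        (hWm.prodMk hGm.ennreal_toReal)).aestronglyMeasurable 1 (ae_of_all _ fun ω => ?_)
      rw [Real.norm_of_nonneg (chebBound_nonneg hα hlam ENNReal.toReal_nonneg _)]
      exact chebBound_le_one _ _ _ _ _ _
    · exact ae_of_all _ fun ω => chebBound_nonneg hα hlam ENNReal.toReal_nonneg _

/-- The bounds on the outage probability, for powers `X n` with Poisson counts. -/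
theorem HasPoissonCounts.outage_bounds {β : ℝ}
    (hα : 2 < α) (hθ : 0 < θ) (hd : 0 < d) (hβ : 0 ≤ β) (hlam : 0 < lam) (hL : 1 ≤ L)
    {μ : Measure ℝ≥0∞} (hX : HasPoissonCounts X μ P)
    (hμ : HasPowerTail μ (tailConst α lam) (delta α)) (hXtop : ∀ n ω, X n ω ≠ ∞)
    (hWm : Measurable W) (hWβ : ∀ᵐ ω ∂P, β * d ^ α ≤ W ω) (hWsing : ∀ w, P.map W {w} = 0)
    (hWX : IndepFun W (fun ω n => X n ω) P) {G : Ω → ℝ}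
    (hGY : ∀ ω, G ω = (primarySup L fun n => X n ω).toReal) {PL : ℝ}
    (hPL : PL = outageLower P L α θ d lam W) {Pout : ℝ}
    (hPout : Pout = P.real {ω | sir L α d (W ω) (fun n => X n ω) ≤ ENNReal.ofReal θ}) :
    PL ≤ Pout ∧ Pout ≤ PL + (1 - PL) * Pα P α θ d lam W G ∧
    (c₄ α ^ 2 * lam ≤ c₃ α * (β / (2 * θ)) ^ delta α →
      Pout ≤ PL + (1 - PL) * Pα' P α θ d lam W G) := by
  have hYm := measurable_primarySup hX.measurable L
  have hWY : IndepFun W (fun ω => primarySup L fun n => X n ω) P :=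
    hWX.comp (φ := id) measurable_id (measurable_iSup_residual L)
  have hWne : ∀ φ : ℝ≥0∞ → ℝ, Measurable φ →
      ∀ᵐ ω ∂P, W ω ≠ φ (primarySup L fun n => X n ω) := fun φ hφ =>
    ae_ne_of_indepFun hWm hYm hWY hWsing hφ
  have hda : 0 < d ^ α := by positivity
  -- For `β = 0` the lower bound on `W` only gives `0 ≤ W`; the value `0` is excluded because it is
  -- not an atom.
  have hW0 : ∀ᵐ ω ∂P, 0 < W ω := by
    filter_upwards [hWβ, hWne (fun _ => 0) measurable_const] with ω h1 h2
    exact lt_of_le_of_ne ((mul_nonneg hβ hda.le).trans h1) (Ne.symm h2)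
  have hYpos := hX.ae_primarySup_pos hμ (tailConst_pos hα hlam) (delta_pos hα) hL
  have hYtop : ∀ᵐ ω ∂P, (primarySup L fun n => X n ω) ≠ ∞ := by
    filter_upwards [hX.ae_finite hμ one_pos] with ω hω
    rw [ENNReal.ofReal_one] at hω
    exact iSup_residual_ne_top (fun n => hXtop n ω) hω
  have hG0 : ∀ ω, 0 ≤ G ω := fun ω => by
    rw [hGY]
    exact ENNReal.toReal_nonneg
  have hGm : Measurable G := by
    rw [funext hGY]
    exact hYm.ennreal_toReal
  set D₀ : Set Ω := {ω | (primarySup L fun n => X n ω) ≤ ENNReal.ofReal (level α θ d (W ω))}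
  set D : Set Ω := {ω | d ^ α * θ < W ω / G ω}
  set O : Set Ω := {ω | ENNReal.ofReal (level α θ d (W ω)) ≤ residualPower L fun n => X n ω}
  have hlevel : ∀ w g : ℝ, level α θ d w = g → w = d ^ α * θ * g := by
    intro w g hwg
    rw [← hwg, level, Real.rpow_neg hd.le]
    field_simp
  have hDlt : ∀ᵐ ω ∂P, ω ∈ D ↔ G ω < level α θ d (W ω) := by
    filter_upwards [hYpos, hYtop] with ω h1 h2
    change d ^ α * θ < W ω / G ω ↔ _
    rw [hGY]
    exact lt_div_toReal_iff hθ hd h1 h2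
  -- The conditioning event is the strict inequality `G < t`, the event split on is `G ≤ t`. They
  -- differ where `W` is a prescribed function of `G`, a null event.
  have hDD : D =ᵐ[P] D₀ := by
    filter_upwards [hDlt, hYtop, hW0, hWne (fun y => d ^ α * θ * y.toReal) (by fun_prop)]
      with ω h1 h2 h3 h4
    have h5 : ω ∈ D₀ ↔ G ω ≤ level α θ d (W ω) := by
      rw [hGY]
      exact ENNReal.le_ofReal_iff_toReal_le h2 (level_pos hθ hd h3).le
    refine propext (h1.trans (Iff.trans ?_ h5.symm))
    refine ⟨le_of_lt, fun h => lt_of_le_of_ne h fun he => h4 ?_⟩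
    rw [hGY] at he
    exact hlevel _ _ he.symm
  have hDm : MeasurableSet D := measurableSet_lt measurable_const (hWm.div hGm)
  have hD₀m : MeasurableSet D₀ :=
    measurableSet_le hYm ((measurable_level α θ d).comp hWm).ennreal_ofReal
  have hPLD₀ : P.real D₀ = 1 - PL := by
    rw [hPL]
    exact hX.measure_primarySup_le_level hα hθ hd hlam hL hμ hWm hW0 hWX
  have hPLD : P.real D = 1 - PL := by rw [← hPLD₀, measureReal_congr hDD]
  have hPL' : P.real D₀ᶜ = PL := by
    rw [probReal_compl_eq_one_sub hD₀m, hPLD₀]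
    ring
  have hPO : Pout = P.real O := by
    rw [hPout]
    refine measureReal_congr ?_
    filter_upwards [hW0] with ω hω
    exact propext (sir_le_iff hθ hd hω)
  have hsub : D₀ᶜ ⊆ O := by
    intro ω hω
    have h : ¬ (primarySup L fun n => X n ω) ≤ ENNReal.ofReal (level α θ d (W ω)) := hω
    exact (not_le.1 h).le.trans iSup_residual_le_residualPower
  have hupper : Pout ≤ PL + ∫ ω in D, chebBound α θ d lam (W ω) (G ω) ∂P := by
    rw [setIntegral_congr_set hDD]
    simp only [hGY]
    have h1 : P.real O ≤ P.real D₀ᶜ + P.real (D₀ ∩ O) := by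
      refine (measureReal_mono ?_).trans (measureReal_union_le _ _)
      intro ω hω
      by_cases h : ω ∈ D₀
      exacts [Or.inr ⟨h, hω⟩, Or.inl h]
    rw [hPL'] at h1
    rw [hPO]
    exact h1.trans (add_le_add_right
      (hX.measure_secondary_le hα hθ hd hlam hL hμ hWm hW0 hWX) PL)
  refine ⟨?_, ?_, fun hsparse => ?_⟩
  · rw [← hPL', hPO]
    exact measureReal_mono hsub
  · rw [← hPLD, Pα, measureReal_mul_integral_cond]
    exact hupper
  · rw [← hPLD, Pα', measureReal_mul_integral_cond]
    refine hupper.trans (add_le_add_right ?_ PL)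
    have hi1 : Integrable (fun ω => chebBound α θ d lam (W ω) (G ω)) P := by
      refine Integrable.of_bound ((measurable_chebBound α θ d lam).comp
        (hWm.prodMk hGm)).aestronglyMeasurable 1 (ae_of_all _ fun ω => ?_)
      rw [Real.norm_of_nonneg (chebBound_nonneg hα hlam (hG0 ω) _)]
      exact chebBound_le_one _ _ _ _ _ _
    have hi2 : Integrable (fun ω => min (chebRatio α θ d lam (W ω) (G ω)) 1) P := by
      refine Integrable.of_bound (((measurable_chebRatio α θ d lam).comp
        (hWm.prodMk hGm)).min measurable_const).aestronglyMeasurable 1 (ae_of_all _ fun ω => ?_)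
      rw [Real.norm_of_nonneg (le_min (chebRatio_nonneg hα hlam (hG0 ω) _) zero_le_one)]
      exact min_le_right _ _
    refine setIntegral_mono_on_ae hi1.integrableOn hi2.integrableOn hDm ?_
    -- The prescribed value of `W` is the one with zero margin. It has to be excluded: there
    -- division by zero makes the ratio `0`, while `chebBound` is `1`.
    filter_upwards [hDlt, hYpos, hYtop, hWβ, hWne (fun y => d ^ α * θ *
      (y.toReal + c₄ α * lam * y.toReal ^ (1 - delta α))) (by fun_prop)] with ω h1 h2 h3 h4 h5 hω
    refine chebBound_le_of_sparse hα hθ hβ hlam hsparse ?_ (h1.1 hω) ?_ ?_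
    · rw [hGY]
      exact ENNReal.toReal_pos h2.ne' h3
    · calc β / θ = level α θ d (β * d ^ α) := by
            rw [level, Real.rpow_neg hd.le]
            field_simp
        _ ≤ level α θ d (W ω) := by
            unfold level
            gcongr
    · intro h6
      refine h5 (hlevel _ _ ?_)
      rw [← hGY]
      have h7 : level α θ d (W ω) - G ω - c₄ α * lam * G ω ^ (1 - delta α) = 0 := h6
      linarith

end Outage

end MANET

theorem proposition1 {Ω : Type*} [MeasurableSpace Ω] (P : Measure Ω) [IsProbabilityMeasure P]
    (L : ℕ) (hL : 1 ≤ L) (α θ d β lam : ℝ) (hα : 2 < α) (hθ : 0 < θ) (hd : 0 < d) (hβ : 0 ≤ β)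
    (hlam : 0 < lam)
    -- the positions of the interferers and their fading powers
    (T : ℕ → Ω → EuclideanSpace ℝ (Fin 2)) (ρ : ℕ → Ω → ℝ)
    (hT : MANET.IsPoissonProcess T (ENNReal.ofReal lam • volume) P)
    (hρm : ∀ n, Measurable (ρ n)) (hρ : ∀ n, HasLaw (ρ n) (expMeasure 1) P)
    (hρi : iIndepFun ρ P)
    (hTρ : IndepFun (fun ω n => T n ω) (fun ω n => ρ n ω) P)
    -- the fading power of the data link
    (W : Ω → ℝ) (hWm : Measurable W) (hW : HasLaw W (MANET.dataGainLaw α d β) P)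
    (hWi : IndepFun W (fun ω => ((fun n => T n ω), (fun n => ρ n ω))) P)
    -- the interference powers, the primary interference power and the outage probability
    (I : Ω → ℕ → ℝ≥0∞) (hI : I = fun ω n => MANET.interfPower α (T n ω) (ρ n ω))
    (G : Ω → ℝ) (hG : G = fun ω => MANET.primaryPower L (I ω))
    (Pout : ℝ) (hPout : Pout = P.real {ω | MANET.sir L α d (W ω) (I ω) ≤ ENNReal.ofReal θ})
    (PL : ℝ) (hPL : PL = MANET.outageLower P L α θ d lam W) :
    PL ≤ Pout ∧
    Pout ≤ PL + (1 - PL) * MANET.Pα P α θ d lam W G ∧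
    (MANET.c₄ α ^ 2 * lam ≤ MANET.c₃ α * (β / (2 * θ)) ^ MANET.delta α →
      Pout ≤ PL + (1 - PL) * MANET.Pα' P α θ d lam W G) := by
  have : IsProbabilityMeasure (expMeasure 1) := isProbabilityMeasure_expMeasure one_pos
  have := MANET.sigmaFinite_ofReal_smul lam (volume : Measure (EuclideanSpace ℝ (Fin 2)))
  subst hI
  have hg := MANET.measurable_interfPower α
  -- Marking the positions with their fading powers and then mapping each pair to its received
  -- power.
  have hX : MANET.HasPoissonCounts (fun n ω => MANET.interfPower α (T n ω) (ρ n ω))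
      (MANET.powerIntensity α lam) P :=
    (hT.hasPoissonCounts.prodMk hρm hρ hρi hTρ).map
      (g := fun p => MANET.interfPower α p.1 p.2) hg
  have hWX : IndepFun W (fun ω n => MANET.interfPower α (T n ω) (ρ n ω)) P :=
    MANET.indepFun_map₂ hg hWi
  have hμ : MANET.HasPowerTail (MANET.powerIntensity α lam) (MANET.tailConst α lam)
      (MANET.delta α) := MANET.hasPowerTail_powerIntensity (by linarith) hlam
  have hGY : ∀ ω, G ω = (MANET.primarySup L
      fun n => MANET.interfPower α (T n ω) (ρ n ω)).toReal := fun ω => by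
    rw [hG]
    rfl
  refine hX.outage_bounds hα hθ hd hβ hlam hL hμ (fun n ω => ENNReal.ofReal_ne_top) hWm
    ?_ (fun w => ?_) hWX hGY hPL hPout
  · have h := MANET.ae_le_dataGainLaw α d β
    rw [← hW.map_eq] at h
    exact ae_of_ae_map hWm.aemeasurable h
  · rw [hW.map_eq]
    exact MANET.dataGainLaw_singleton α d β w
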